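/- **Theorem 1.2.** All graphs are finite undirected graphs in which parallel edges are allowed (every edge has unit capacity). Let $G$ be a graph and $T\subseteq V(G)$ a set of terminals. A *demand* $\mathcal D$ on $T$ assigns a real number $\mathcal D(t,t')\ge 0$ to every unordered pair of distinct terminals. A multicommodity flow is a nonnegative weighting of the paths of $G$ between terminals; it *routes* $\mathcal D$ if for all distinct $t,t'\in T$ the total weight of the paths between $t$ and $t'$ is $\mathcal D(t,t')$. Its congestion is the maximum, over the edges $e$ of $G$, of the total weight of the paths that contain $e$, and $\mathrm{cong}_G(\mathcal D)$ is the minimum congestion of a flow in $G$ that routes $\mathcal D$ ($\infty$ if there is none). A graph $H$ with $T\subseteq V(H)$ is a *flow sparsifier of $G$ with respect to $T$ with quality $q\ge 1$* if $$\mathrm{cong}_H(\mathcal D)\le \mathrm{cong}_G(\mathcal D)\le q\cdot \mathrm{cong}_H(\mathcal D)\qquad\text{for every demand }\mathcal D\text{ on }T.$$ It is *contraction-based* if there is a partition $\mathcal F$ of $V(G)$ in which distinct terminals lie in distinct sets, such that $H$ is obtained from $G$ by contracting every set of $\mathcal F$ into a single node, keeping parallel edges and discarding self-loops, where the node of the set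 that contains a terminal $t$ is identified with $t$. For every positive integer $N$ there exist a graph $G$ and a set $T$ of $6$ terminals in $G$ such that, whenever $H$ is a contraction-based flow sparsifier of $G$ with respect to $T$ on at most $N$ vertices and $H$ has quality $q$, then $q\ge 1+10^{-18}$. -/

import Mathlib

open scoped NNReal ENNReal

namespace FlowSparsifier

/-- Walks from `u` to `v` in a multigraph `G`; an edge is recorded by its name, so that parallel
edges are told apart. -/
inductive Walk {V E : Type*} (G : Graph V E) : V → V → Type _
  | nil {u : V} (hu : u ∈ G.vertexSet) : Walk G u u
  | cons {u v w : V} (e : E) (h : G.IsLink e u v) (p : Walk G v w) : Walk G u w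

/-- The list of vertices visited by a walk. -/
def Walk.support {V E : Type*} {G : Graph V E} : {u v : V} → Walk G u v → List V
  | u, _, .nil _ => [u]
  | u, _, .cons _ _ p => u :: p.support

/-- The list of edges traversed by a walk. -/
def Walk.edges {V E : Type*} {G : Graph V E} : {u v : V} → Walk G u v → List E
  | _, _, .nil _ => []
  | _, _, .cons e _ p => e :: p.edges

/-- Paths from `u` to `v`: walks that visit no vertex twice. -/
abbrev Path {V E : Type*} (G : Graph V E) (u v : V) : Type _ :=
  {p : Walk G u v // p.support.Nodup}

/-- A multicommodity flow between terminals. The terminals are named by `K`, and `τ t` is the vertex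
of `G` that the terminal `t` is. The flow sends the amount `F s t P ≥ 0` along the path `P` from
`s` to `t`. -/
abbrev Flow {V E K : Type*} (G : Graph V E) (τ : K → V) : Type _ :=
  (s t : K) → Path G (τ s) (τ t) →₀ ℝ≥0

/-- A demand: a nonnegative real number for every unordered pair of terminals. -/
abbrev Demand (K : Type*) : Type _ := Sym2 K → ℝ≥0

/-- `F` routes `D`: for any two distinct terminals `s, t`, the amount sent from `s` to `t` plus the
amount sent from `t` to `s` is the demand of the pair. -/
def Flow.Routes {V E K : Type*} {G : Graph V E} {τ : K → V} (F : Flow G τ) (D : Demand K) : Prop :=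
  ∀ s t : K, s ≠ t → ((F s t).sum fun _ x => x) + ((F t s).sum fun _ x => x) = D s(s, t)

open Classical in
/-- The total amount of flow sent via the edge `e`, in both directions and over all commodities. -/
noncomputable def Flow.onEdge {V E K : Type*} [Fintype K] {G : Graph V E} {τ : K → V}
    (F : Flow G τ) (e : E) : ℝ≥0 :=
  ∑ s : K, ∑ t : K, (F s t).sum fun P x => if e ∈ P.1.edges then x else 0

/-- The congestion of a flow: the maximum amount of flow sent via a single edge. -/
noncomputable def Flow.congestion {V E K : Type*} [Fintype K] {G : Graph V E} {τ : K → V}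
    (F : Flow G τ) : ℝ≥0∞ :=
  ⨆ e ∈ G.edgeSet, (F.onEdge e : ℝ≥0∞)

/-- The congestion of a demand: the least congestion of a flow that routes it (`∞` if there is no
such flow). -/
noncomputable def congestion {V E K : Type*} [Fintype K] (G : Graph V E) (τ : K → V)
    (D : Demand K) : ℝ≥0∞ :=
  ⨅ (F : Flow G τ) (_ : F.Routes D), F.congestion

/-- `H`, with terminals placed by `σ`, is a flow sparsifier of quality `q` of `G`, with the same
terminals placed by `τ`. -/
def IsFlowSparsifier {V E V' E' K : Type*} [Fintype K] (G : Graph V E) (τ : K → V)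
    (H : Graph V' E') (σ : K → V') (q : ℝ) : Prop :=
  1 ≤ q ∧ ∀ D : Demand K,
    congestion H σ D ≤ congestion G τ D ∧
      congestion G τ D ≤ ENNReal.ofReal q * congestion H σ D

/-- The graph obtained from `G` by contracting every class of the partition `𝓕` of the vertices
into a single node, keeping parallel edges and discarding loops. (For `𝓕` a partition of the ambient
type `V`, the nodes are the classes that contain a vertex of `G`.) -/
def contract {V E : Type*} (G : Graph V E) (𝓕 : Setoid V) : Graph (Quotient 𝓕) E :=
  (G.map (Quotient.mk 𝓕)).deleteEdges {e | ∃ x, (G.map (Quotient.mk 𝓕)).IsLoopAt e x}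

end FlowSparsifier

/-!
The graph is a discrete torus `(ℤ / 2L)³` in which every point `x` is joined to the eight points
`x + (±1, ±1, ±1)`. The `j`-th height of a point is the distance of its `j`-th coordinate from `0` on
the cycle, and for `j = 0, 1, 2` a pair of terminals is attached to the two planes where the `j`-th
height is minimal and maximal. The demand is one unit for each of the three pairs.

Every edge of the torus changes all three heights by one, so one edge of length one serves all three
pairs at once: with the three heights as potentials, duality bounds the congestion of the demand in
the torus from below (`le_congestion_torusGraph`).

In a contraction to `N` vertices, duality turns edge lengths into a triple `Ψ` of potentials that
has at most `N` values on the torus. Such a `Ψ` cannot imitate the heights. Call the defect of an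
edge the amount by which the three coordinates of `Ψ` fail to increase all by the length of the edge
in the directions of the heights. If there were no defect, then going around parallelograms would
show that `Ψ` is affine wherever the heights are affine (`TightUpTo.parallelogram`), at every scale;
quantitatively, the second differences of `Ψ` along a line are bounded by the defect, at every
dyadic scale. But a function with `N` values on `2 ^ K` points has, on average over the `K` dyadic
scales, second differences at least half as large as its increments once `K ≥ 2 N`
(`le_dyadicVariation`). So the total defect is at least a constant fraction, independent of `N`, of
the length of `Ψ` in the part of the torus where the heights are affine (`sum_sum_inc_flat_le`).

The planes, near which the heights are not affine, and the edges at the terminals escape this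
argument. They get slightly more capacity, so that a potential that concentrates its increments
there gains nothing either. This gives `le_weighted_sum`, hence the upper bound
`congestion_contract_le` for the congestion in the contraction, which is smaller by a constant
factor than the lower bound above.

The two halves of duality that are used are `le_congestion_unitDemand`, which is a direct
computation, and `congestion_unitDemand_le`, which rests on the separation of convex sets.
-/

namespace FlowSparsifier

/-! ### Dyadic second differences of functions with few values -/

/-- The sum of the absolute second differences of `f` over all the intervals of the dyadic
subdivision of `[a, a + 2 ^ K]` that have positive level. -/
def dyadicVariation (f : ℕ → ℝ) : ℕ → ℕ → ℝ
  | 0, _ => 0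
  | K + 1, a => |f (a + 2 ^ (K + 1)) - 2 * f (a + 2 ^ K) + f a| +
      dyadicVariation f K a + dyadicVariation f K (a + 2 ^ K)

/-- A monotone function with few values is constant on one half of most dyadic intervals, and there
the second difference is as large as the increment. -/
lemma le_dyadicVariation_of_monotone {f : ℕ → ℝ} (hf : Monotone f) (K a : ℕ) :
    ((K : ℝ) + 2 - ((Finset.Icc a (a + 2 ^ K)).image f).card) * (f (a + 2 ^ K) - f a) ≤
      dyadicVariation f K a := by
  induction K generalizing a with
  | zero =>
    simp only [dyadicVariation, pow_zero]
    rcases (hf (Nat.le_succ a)).eq_or_lt with h | h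
    · have : f (a + 1) - f a = 0 := sub_eq_zero.2 h.symm
      simp [this]
    · have h2 : ({f a, f (a + 1)} : Finset ℝ) ⊆ (Finset.Icc a (a + 1)).image f := by
        intro y hy
        simp only [Finset.mem_insert, Finset.mem_singleton] at hy
        rcases hy with rfl | rfl <;> exact Finset.mem_image_of_mem _ (by simp)
      have h3 := Finset.card_le_card h2
      rw [Finset.card_pair h.ne] at h3
      have h4 : (2 : ℝ) ≤ ((Finset.Icc a (a + 1)).image f).card := by exact_mod_cast h3
      have h5 : f a < f (a + 1) := h
      push_cast
      nlinarith
  | succ K ih =>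
    have hb : a + 2 ^ (K + 1) = a + 2 ^ K + 2 ^ K := by ring
    have ihl := ih a
    have ihr := ih (a + 2 ^ K)
    simp only [dyadicVariation, hb] at *
    set b := a + 2 ^ K with hbdef
    set c := b + 2 ^ K with hcdef
    have hab : a ≤ b := Nat.le_add_right _ _
    have hbc : b ≤ c := Nat.le_add_right _ _
    have hfab := hf hab
    have hfbc := hf hbc
    set SL := (Finset.Icc a b).image f
    set SR := (Finset.Icc b c).image f
    set S := (Finset.Icc a c).image f with hS
    have hunion : SL ∪ SR = S := by
      rw [← Finset.image_union]
      congr 1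
      ext x
      simp only [Finset.mem_union, Finset.mem_Icc]
      omega
    have hinter : SL ∩ SR ⊆ {f b} := by
      intro y hy
      simp only [SL, SR, Finset.mem_inter, Finset.mem_image, Finset.mem_Icc] at hy
      obtain ⟨⟨i, hi, rfl⟩, j, hj, hij⟩ := hy
      have h1 := hf hi.2
      have h2 := hf hj.1
      rw [Finset.mem_singleton]
      exact le_antisymm h1 (hij ▸ h2)
    have hcard := Finset.card_union_add_card_inter SL SR
    rw [hunion] at hcard
    have hi1 := Finset.card_le_card hinter
    rw [Finset.card_singleton] at hi1
    have hLS : SL.card ≤ S.card := Finset.card_le_card (hunion ▸ Finset.subset_union_left)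
    have hRS : SR.card ≤ S.card := Finset.card_le_card (hunion ▸ Finset.subset_union_right)
    have hL : f a ∈ SL := Finset.mem_image_of_mem _ (by simp [hab])
    have hL' : f b ∈ SL := Finset.mem_image_of_mem _ (by simp [hab])
    have hR : f b ∈ SR := Finset.mem_image_of_mem _ (by simp [hbc])
    have hR' : f c ∈ SR := Finset.mem_image_of_mem _ (by simp [hbc])
    have hLpos : 1 ≤ SL.card := Finset.card_pos.2 ⟨_, hL⟩
    have hRpos : 1 ≤ SR.card := Finset.card_pos.2 ⟨_, hR⟩
    push_cast
    rcases hLpos.eq_or_lt with h1 | h1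
    · have hz : f a = f b := Finset.card_le_one.1 h1.ge _ hL _ hL'
      have h3 : (SR.card : ℝ) ≤ S.card := by exact_mod_cast hRS
      have h4 : |f c - 2 * f b + f a| = f c - f b := by
        rw [hz, abs_of_nonneg (by linarith)]; ring
      rw [h4, hz]
      rw [hz] at ihl
      nlinarith
    rcases hRpos.eq_or_lt with h2 | h2
    · have hz : f b = f c := Finset.card_le_one.1 h2.ge _ hR _ hR'
      have h3 : (SL.card : ℝ) ≤ S.card := by exact_mod_cast hLS
      have h4 : |f c - 2 * f b + f a| = f b - f a := by
        rw [← hz, abs_of_nonpos (by linarith)]; ring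
      rw [h4, ← hz]
      rw [← hz] at ihr
      nlinarith
    have h3 : (SL.card : ℝ) + 1 ≤ S.card := by exact_mod_cast (by omega : SL.card + 1 ≤ S.card)
    have h4 : (SR.card : ℝ) + 1 ≤ S.card := by exact_mod_cast (by omega : SR.card + 1 ≤ S.card)
    have h5 := abs_nonneg (f c - 2 * f b + f a)
    nlinarith

lemma abs_sub_le_sum_abs_sub (g : ℕ → ℝ) (a n : ℕ) :
    |g (a + n) - g a| ≤ ∑ i ∈ Finset.range n, |g (a + i + 1) - g (a + i)| := by
  induction n with
  | zero => simp
  | succ n ih =>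
    rw [Finset.sum_range_succ]
    have := abs_sub_le (g (a + (n + 1))) (g (a + n)) (g a)
    rw [← add_assoc] at *
    linarith

lemma dyadicVariation_le (g : ℕ → ℝ) (K a : ℕ) :
    dyadicVariation g K a ≤ K * ∑ i ∈ Finset.range (2 ^ K), |g (a + i + 1) - g (a + i)| := by
  induction K generalizing a with
  | zero => simp [dyadicVariation]
  | succ K ih =>
    have h1 := ih a
    have h2 := ih (a + 2 ^ K)
    have h3 := abs_sub_le_sum_abs_sub g a (2 ^ K)
    have h4 := abs_sub_le_sum_abs_sub g (a + 2 ^ K) (2 ^ K)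
    have hb : a + 2 ^ (K + 1) = a + 2 ^ K + 2 ^ K := by ring
    have h5 : |g (a + 2 ^ K + 2 ^ K) - 2 * g (a + 2 ^ K) + g a| ≤
        |g (a + 2 ^ K + 2 ^ K) - g (a + 2 ^ K)| + |g (a + 2 ^ K) - g a| := by
      have h : g (a + 2 ^ K + 2 ^ K) - 2 * g (a + 2 ^ K) + g a =
          (g (a + 2 ^ K + 2 ^ K) - g (a + 2 ^ K)) - (g (a + 2 ^ K) - g a) := by ring
      rw [h]
      exact abs_sub _ _
    have h6 : ∑ i ∈ Finset.range (2 ^ (K + 1)), |g (a + i + 1) - g (a + i)| =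
        ∑ i ∈ Finset.range (2 ^ K), |g (a + i + 1) - g (a + i)| +
        ∑ i ∈ Finset.range (2 ^ K), |g (a + 2 ^ K + i + 1) - g (a + 2 ^ K + i)| := by
      rw [pow_succ, mul_two, Finset.sum_range_add]
      simp only [add_assoc]
    simp only [dyadicVariation, hb, h6]
    push_cast
    nlinarith

lemma dyadicVariation_add_le (f g : ℕ → ℝ) (K a : ℕ) :
    dyadicVariation (fun i => f i + g i) K a ≤ dyadicVariation f K a + dyadicVariation g K a := by
  induction K generalizing a with
  | zero => simp [dyadicVariation]
  | succ K ih =>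
    have h1 := ih a
    have h2 := ih (a + 2 ^ K)
    simp only [dyadicVariation]
    have := abs_add_le (f (a + 2 ^ (K + 1)) - 2 * f (a + 2 ^ K) + f a)
      (g (a + 2 ^ (K + 1)) - 2 * g (a + 2 ^ K) + g a)
    have h3 : f (a + 2 ^ (K + 1)) + g (a + 2 ^ (K + 1)) - 2 * (f (a + 2 ^ K) + g (a + 2 ^ K)) +
      (f a + g a) = (f (a + 2 ^ (K + 1)) - 2 * f (a + 2 ^ K) + f a) +
      (g (a + 2 ^ (K + 1)) - 2 * g (a + 2 ^ K) + g a) := by ring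
    rw [h3]
    linarith

/-- The variation of the gap between `f` and its running maximum is at most twice the negative
variation of `f`. -/
lemma sum_abs_partialSups_sub_le (f : ℕ → ℝ) (n : ℕ) :
    ∑ i ∈ Finset.range n, |(partialSups f (i + 1) - f (i + 1)) - (partialSups f i - f i)| +
      (partialSups f n - f n) ≤
      ∑ i ∈ Finset.range n, (|f (i + 1) - f i| - (f (i + 1) - f i)) := by
  induction n with
  | zero => simp
  | succ n ih =>
    rw [Finset.sum_range_succ, Finset.sum_range_succ]
    have h0 : f n ≤ partialSups f n := le_partialSups f n
    have h1 : partialSups f (n + 1) = partialSups f n ⊔ f (n + 1) := by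
      simp
    rw [h1]
    rcases le_total (partialSups f n) (f (n + 1)) with h | h
    · rw [sup_eq_right.2 h, abs_of_nonpos (by linarith)]
      have := le_abs_self (f (n + 1) - f n)
      linarith
    · rw [sup_eq_left.2 h]
      have h2 : partialSups f n - f (n + 1) - (partialSups f n - f n) = -(f (n + 1) - f n) := by
        ring
      rw [h2, abs_neg]
      linarith

/-- A function on `[0, 2 ^ K]` with at most `N` values, not necessarily monotone. The comparison
with its running maximum costs `K` times the excess of the variation over the increment. -/
lemma le_dyadicVariation (f : ℕ → ℝ) (K N : ℕ)
    (hN : (Finset.image f (Finset.range (2 ^ K + 1))).card ≤ N) (hNK : N ≤ K) :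
    ((K : ℝ) - N) * (f (2 ^ K) - f 0) ≤ dyadicVariation f K 0 +
      K * ∑ i ∈ Finset.range (2 ^ K), (|f (i + 1) - f i| - (f (i + 1) - f i)) := by
  set F : ℕ → ℝ := fun i => partialSups f i with hF
  have hmono : Monotone F := (partialSups f).monotone
  have h1 := le_dyadicVariation_of_monotone hmono K 0
  have hsub : (Finset.Icc 0 (0 + 2 ^ K)).image F ⊆ Finset.image f (Finset.range (2 ^ K + 1)) := by
    intro y hy
    obtain ⟨i, hi, rfl⟩ := Finset.mem_image.1 hy
    obtain ⟨j, hj, hij⟩ := exists_partialSups_eq f i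
    simp only [Finset.mem_Icc] at hi
    exact Finset.mem_image.2 ⟨j, by simp; omega, hij.symm⟩
  have h2 : (((Finset.Icc 0 (0 + 2 ^ K)).image F).card : ℝ) ≤ N := by
    exact_mod_cast (Finset.card_le_card hsub).trans hN
  have h3 := dyadicVariation_add_le f (fun i => F i - f i) K 0
  have h4 := dyadicVariation_le (fun i => F i - f i) K 0
  have h5 := sum_abs_partialSups_sub_le f (2 ^ K)
  have h6 : f (2 ^ K) ≤ F (2 ^ K) := le_partialSups f _
  have h7 : F 0 = f 0 := partialSups_zero f
  have h8 : (fun i => f i + (F i - f i)) = F := by ext i; ring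
  have h9 : (N : ℝ) ≤ K := by exact_mod_cast hNK
  have h10 : F 0 ≤ F (2 ^ K) := hmono (Nat.zero_le _)
  rw [h8] at h3
  simp only [zero_add] at *
  have h11 : (K : ℝ) * ∑ i ∈ Finset.range (2 ^ K), |F (i + 1) - f (i + 1) - (F i - f i)| ≤
      K * ∑ i ∈ Finset.range (2 ^ K), (|f (i + 1) - f i| - (f (i + 1) - f i)) := by
    apply mul_le_mul_of_nonneg_left _ (Nat.cast_nonneg K)
    have : 0 ≤ F (2 ^ K) - f (2 ^ K) := by linarith
    simp only [hF] at *
    linarith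
  have h12 : ((K : ℝ) - N) * (f (2 ^ K) - f 0) ≤
      ((K : ℝ) + 2 - ((Finset.Icc 0 (2 ^ K)).image F).card) * (F (2 ^ K) - F 0) := by
    have h13 : f (2 ^ K) - f 0 ≤ F (2 ^ K) - F 0 := by linarith
    apply (mul_le_mul_of_nonneg_left h13 (by linarith)).trans
    exact mul_le_mul_of_nonneg_right (by linarith) (by linarith)
  linarith

/-! ### Rigidity of tight potentials on the body-centred lattice -/

/-- The eight directions of the edges of the body-centred cubic lattice, as sign patterns. -/
abbrev Dir : Type := Fin 3 → ℤˣ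

/-- The lattice vector of a direction. -/
def Dir.vec (w : Dir) : Fin 3 → ℤ := fun j => (w j : ℤ)

/-- The direction that agrees with `v` in the coordinate `j` only. -/
def Dir.flip (j : Fin 3) (v : Dir) : Dir := fun i => if i = j then v i else -v i

lemma Dir.vec_add_flip (v : Dir) :
    v.vec + (Dir.flip 0 v).vec + (Dir.flip 1 v).vec + (Dir.flip 2 v).vec = 0 := by
  ext i
  fin_cases i <;> simp [Dir.vec, Dir.flip]

lemma Dir.vec_eq_or (w : Dir) (j : Fin 3) : w.vec j = 1 ∨ w.vec j = -1 := by
  rcases Int.units_eq_one_or (w j) with h | h <;> simp [Dir.vec, h]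

/-- The points of `ℤ³` at sup-distance at most `R` from the origin. -/
def Box (R : ℤ) (p : Fin 3 → ℤ) : Prop := ∀ j, |p j| ≤ R

/-- `g` is tight up to `e` in the box of radius `R`: along an edge of direction `w`, the signed
increments of the three coordinates of `g` agree up to `e w`. -/
def TightUpTo (R : ℤ) (g : (Fin 3 → ℤ) → Fin 3 → ℝ) (e : Dir → (Fin 3 → ℤ) → ℝ) : Prop :=
  ∀ w q, Box R q → Box R (q + w.vec) → ∀ i j,
    |(w.vec i : ℝ) * (g (q + w.vec) i - g q i) - w.vec j * (g (q + w.vec) j - g q j)| ≤ e w q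

/-- The sum of `e w` over the `s` edges from `p` in direction `w`. -/
def lineSum {M : Type*} [AddCommMonoid M] (e : M → ℝ) (w : M) (s : ℕ) (p : M) : ℝ :=
  ∑ i ∈ Finset.range s, e (p + i • w)

lemma Box.of_add_succ_smul {R : ℤ} {p : Fin 3 → ℤ} {w : Dir} {n : ℕ} (h0 : Box R p)
    (h1 : Box R (p + (n + 1) • w.vec)) : Box R (p + n • w.vec) := by
  intro j
  have h2 := abs_le.1 (h0 j)
  have h3 := abs_le.1 (h1 j)
  simp only [Pi.add_apply, nsmul_eq_mul, Pi.mul_apply, Pi.natCast_apply,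
    Pi.one_apply, Nat.cast_add, Nat.cast_one] at *
  rw [abs_le]
  rcases w.vec_eq_or j with h | h <;> rw [h] at h3 ⊢ <;> constructor <;> omega

lemma TightUpTo.abs_sub_le_lineSum {R : ℤ} {g : (Fin 3 → ℤ) → Fin 3 → ℝ}
    {e : Dir → (Fin 3 → ℤ) → ℝ} (h : TightUpTo R g e) (w : Dir) (p : Fin 3 → ℤ) (s : ℕ)
    (hp : Box R p) (hs : Box R (p + s • w.vec)) (i j : Fin 3) :
    |(w.vec i : ℝ) * (g (p + s • w.vec) i - g p i) - w.vec j * (g (p + s • w.vec) j - g p j)| ≤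
      lineSum (e w) w.vec s p := by
  induction s with
  | zero => simp [lineSum]
  | succ n ih =>
    have hn := hp.of_add_succ_smul hs
    have h1 := ih hn
    have hq : p + (n + 1) • w.vec = p + n • w.vec + w.vec := by rw [succ_nsmul, add_assoc]
    have h2 := h w (p + n • w.vec) hn (hq ▸ hs) i j
    rw [lineSum, Finset.sum_range_succ, ← lineSum, hq]
    refine le_trans (le_of_eq_of_le ?_ (abs_add_le _ _)) (add_le_add h1 h2)
    congr 1
    ring

/-- The parallelogram law: of the two coordinates `0` and `i`, one has the same sign in the
directions `u` and `v`, the other has opposite signs; going around a parallelogram with sides `u`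
and `v`, the two coordinates of `g` give `a + c = d + b` and `a - c = b - d`, and so `a = b`. -/
lemma TightUpTo.parallelogram {R : ℤ} {g : (Fin 3 → ℤ) → Fin 3 → ℝ}
    {e : Dir → (Fin 3 → ℤ) → ℝ} (h : TightUpTo R g e) {u v : Dir} (i : Fin 3)
    (huv : u.vec i * v.vec i = -(u.vec 0 * v.vec 0)) (p : Fin 3 → ℤ) (s : ℕ)
    (h00 : Box R p) (h10 : Box R (p + s • v.vec)) (h01 : Box R (p + s • u.vec))
    (h11 : Box R (p + s • v.vec + s • u.vec)) :
    |(v.vec 0 : ℝ) * (g (p + s • v.vec) 0 - g p 0) -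
        v.vec 0 * (g (p + s • u.vec + s • v.vec) 0 - g (p + s • u.vec) 0)| ≤
      (lineSum (e v) v.vec s p + lineSum (e v) v.vec s (p + s • u.vec) +
        lineSum (e u) u.vec s p + lineSum (e u) u.vec s (p + s • v.vec)) / 2 := by
  have hc : p + s • v.vec + s • u.vec = p + s • u.vec + s • v.vec := add_right_comm _ _ _
  have h1 := h.abs_sub_le_lineSum v p s h00 h10 0 i
  have h2 := h.abs_sub_le_lineSum v (p + s • u.vec) s h01 (hc ▸ h11) 0 i
  have h3 := h.abs_sub_le_lineSum u p s h00 h01 0 i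
  have h4 := h.abs_sub_le_lineSum u (p + s • v.vec) s h10 h11 0 i
  rw [hc] at h4
  generalize lineSum (e v) v.vec s p = A1 at *
  generalize lineSum (e v) v.vec s (p + s • u.vec) = A2 at *
  generalize lineSum (e u) u.vec s p = A3 at *
  generalize lineSum (e u) u.vec s (p + s • v.vec) = A4 at *
  generalize g (p + s • u.vec + s • v.vec) = g11 at *
  generalize g (p + s • u.vec) = g01 at *
  generalize g (p + s • v.vec) = g10 at *
  generalize g p = g00 at *
  rw [abs_le] at *
  rcases u.vec_eq_or 0 with a | a <;> rcases v.vec_eq_or 0 with b | b <;>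
    rcases u.vec_eq_or i with c | c <;> rcases v.vec_eq_or i with d | d <;>
    simp only [a, b, c, d] at huv h1 h2 h3 h4 ⊢ <;> norm_num at huv <;>
    push_cast at * <;> constructor <;> linarith

/-- The bound on the second differences, at the scale `s` and along the direction `v`, that three
parallelograms give. Their second directions are the three flips of `v`, which add up to `-v`, so
that together they carry the edge from `p + s v` to `p + 2 s v` to the edge from `p` to `p + s v`.
The map `c` places the lattice vectors in `M`. -/
noncomputable def secondDiffBound {M : Type*} [AddCommMonoid M] (e : Dir → M → ℝ)
    (c : (Fin 3 → ℤ) → M) (v : Dir) (s : ℕ) (p : M) : ℝ :=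
  let u := fun j => Dir.flip j v
  let V := c v.vec
  let U := fun j => c (u j).vec
  (lineSum (e v) V s (p + s • V) + lineSum (e v) V s (p + s • V + s • U 0) +
    lineSum (e (u 0)) (U 0) s (p + s • V) + lineSum (e (u 0)) (U 0) s (p + s • V + s • V) +
    (lineSum (e v) V s (p + s • V + s • U 0) + lineSum (e v) V s (p + s • V + s • U 0 + s • U 1) +
      lineSum (e (u 1)) (U 1) s (p + s • V + s • U 0) +
      lineSum (e (u 1)) (U 1) s (p + s • V + s • U 0 + s • V)) +
    (lineSum (e v) V s (p + s • V + s • U 0 + s • U 1) +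
      lineSum (e v) V s (p + s • V + s • U 0 + s • U 1 + s • U 2) +
      lineSum (e (u 2)) (U 2) s (p + s • V + s • U 0 + s • U 1) +
      lineSum (e (u 2)) (U 2) s (p + s • V + s • U 0 + s • U 1 + s • V))) / 2

lemma TightUpTo.abs_secondDiff_le {R : ℤ} {g : (Fin 3 → ℤ) → Fin 3 → ℝ}
    {e : Dir → (Fin 3 → ℤ) → ℝ} (h : TightUpTo R g e) (v : Dir) (p : Fin 3 → ℤ) (s : ℕ)
    (hp : Box (R - 3 * s) p) :
    |g (p + s • v.vec + s • v.vec) 0 - 2 * g (p + s • v.vec) 0 + g p 0| ≤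
      secondDiffBound e id v s p := by
  set u := fun j => Dir.flip j v with hu
  have hsum : p + s • v.vec + s • (u 0).vec + s • (u 1).vec + s • (u 2).vec = p := by
    have := v.vec_add_flip
    rw [add_assoc, add_assoc, add_assoc, ← smul_add, ← smul_add, ← smul_add, ← add_assoc,
      ← add_assoc, this, smul_zero, add_zero]
  have hbox : ∀ q : Fin 3 → ℤ, (∀ j, |q j - p j| ≤ 3 * s) → Box R q := by
    intro q hq j
    have h1 := abs_le.1 (hp j)
    have h2 := abs_le.1 (hq j)
    rw [abs_le]
    constructor <;> linarith
  have hv : ∀ j, v.vec j = 1 ∨ v.vec j = -1 := v.vec_eq_or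
  have hflip : ∀ i j, (u i).vec j = if j = i then v.vec j else - v.vec j := by
    intro i j
    simp only [hu, Dir.flip, Dir.vec]
    split_ifs <;> simp
  have hsq : ∀ j, v.vec j * v.vec j = 1 := by
    intro j
    rcases hv j with h0 | h0 <;> simp [h0]
  have e1 := h.parallelogram (u := u 0) (v := v) 1 (by simp [hflip, hsq]) (p + s • v.vec) s
    (hbox _ ?_) (hbox _ ?_) (hbox _ ?_) (hbox _ ?_)
  have e2 := h.parallelogram (u := u 1) (v := v) 1 (by simp [hflip, hsq])
    (p + s • v.vec + s • (u 0).vec) s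
    (hbox _ ?_) (hbox _ ?_) (hbox _ ?_) (hbox _ ?_)
  have e3 := h.parallelogram (u := u 2) (v := v) 2 (by simp [hflip, hsq])
    (p + s • v.vec + s • (u 0).vec + s • (u 1).vec) s
    (hbox _ ?_) (hbox _ ?_) (hbox _ ?_) (hbox _ ?_)
  · simp only [secondDiffBound, id]
    rw [hsum] at e3 ⊢
    rw [abs_le] at *
    generalize lineSum (e v) v.vec s _ = B1 at *
    rcases hv 0 with h0 | h0 <;> simp only [h0] at e1 e2 e3 <;> push_cast at e1 e2 e3 <;>
      constructor <;> linarith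
  all_goals
    intro j
    rw [abs_le]
    rcases hv j with h0 | h0 <;> fin_cases j <;> simp at h0 <;> simp [h0, hflip] <;>
      constructor <;> linarith

/-! ### Heights and defects on a torus -/

/-- The discrete torus of side `m`. -/
abbrev Torus (m : ℕ) : Type := Fin 3 → ZMod m

/-- Reduction of integer vectors modulo `m`. -/
def toTorus (m : ℕ) : (Fin 3 → ℤ) →+ Torus m := (Int.castAddHom (ZMod m)).compLeft (Fin 3)

lemma toTorus_apply (m : ℕ) (p : Fin 3 → ℤ) (j : Fin 3) : toTorus m p j = (p j : ZMod m) := rfl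

/-- The distance from `0` on the cycle of length `m`. -/
noncomputable def height (m : ℕ) (a : ZMod m) : ℝ := min (a.val : ℝ) (m - a.val)

/-- The sup-norm of the increment of `Ψ` along the edge from `x` in direction `w`. -/
noncomputable def inc {m : ℕ} (Ψ : Torus m → Fin 3 → ℝ) (w : Dir) (x : Torus m) : ℝ :=
  ‖Ψ (x + toTorus m w.vec) - Ψ x‖

/-- The increment of the `j`-th height along the edge from `x` in direction `w`. -/
noncomputable def slope {m : ℕ} (w : Dir) (x : Torus m) (j : Fin 3) : ℝ :=
  height m (x j + (w.vec j : ZMod m)) - height m (x j)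

/-- The defect of `Ψ` along an edge: how much the three coordinates of `Ψ` together fall short of
increasing, in the directions in which the heights increase, by the sup-norm of the increment. -/
noncomputable def defect {m : ℕ} (Ψ : Torus m → Fin 3 → ℝ) (w : Dir) (x : Torus m) : ℝ :=
  ∑ j, (inc Ψ w x - slope w x j * (Ψ (x + toTorus m w.vec) j - Ψ x j))

/-- Every height is affine, with slope `1` or `-1`, at distance at most `r` from `x`. -/
def Flat {m : ℕ} (r : ℤ) (x : Torus m) : Prop :=
  ∃ κ : Fin 3 → ℝ, (∀ j, κ j = 1 ∨ κ j = -1) ∧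
    ∀ j, ∀ a : ℤ, |a| ≤ r → height m (x j + (a : ZMod m)) = height m (x j) + κ j * a

lemma height_intCast_of_le {L : ℕ} [NeZero L] {a : ℤ} (h0 : 0 ≤ a) (h1 : a ≤ L) :
    height (2 * L) (a : ZMod (2 * L)) = a := by
  have hL : 0 < L := Nat.pos_of_ne_zero (NeZero.ne L)
  obtain ⟨n, rfl⟩ := Int.eq_ofNat_of_zero_le h0
  have h2 : n ≤ L := by exact_mod_cast h1
  have h3 : ((n : ℤ) : ZMod (2 * L)).val = n := by
    rw [Int.cast_natCast, ZMod.val_natCast, Nat.mod_eq_of_lt (by omega)]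
  have h4 : (n : ℝ) ≤ L := by exact_mod_cast h2
  rw [height, h3]
  push_cast
  rw [min_eq_left (by linarith)]

lemma height_intCast_of_ge {L : ℕ} [NeZero L] {a : ℤ} (h0 : (L : ℤ) ≤ a) (h1 : a ≤ 2 * L) :
    height (2 * L) (a : ZMod (2 * L)) = 2 * L - a := by
  have hL : 0 < L := Nat.pos_of_ne_zero (NeZero.ne L)
  rcases h1.eq_or_lt with rfl | h1
  · have : ((2 * L : ℤ) : ZMod (2 * L)) = 0 := by
      have := ZMod.natCast_self (2 * L)
      push_cast at this ⊢
      exact this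
    rw [this, height]
    simp
  obtain ⟨n, rfl⟩ := Int.eq_ofNat_of_zero_le ((Int.natCast_nonneg L).trans h0)
  have h2 : L ≤ n := by exact_mod_cast h0
  have h3 : ((n : ℤ) : ZMod (2 * L)).val = n := by
    rw [Int.cast_natCast, ZMod.val_natCast, Nat.mod_eq_of_lt (by omega)]
  have h4 : (L : ℝ) ≤ n := by exact_mod_cast h2
  rw [height, h3]
  push_cast
  rw [min_eq_right (by linarith)]

lemma height_add_one {L : ℕ} [NeZero L] (a : ZMod (2 * L)) :
    height (2 * L) (a + 1) = height (2 * L) a + if a.val < L then 1 else -1 := by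
  have hlt : a.val < 2 * L := ZMod.val_lt a
  have h1 : a = ((a.val : ℤ) : ZMod (2 * L)) := by simp
  have h2 : a + 1 = ((a.val + 1 : ℤ) : ZMod (2 * L)) := by simp
  split_ifs with h
  · have e1 := height_intCast_of_le (L := L) (a := a.val) (by omega) (by omega)
    have e2 := height_intCast_of_le (L := L) (a := a.val + 1) (by omega) (by omega)
    rw [← h1] at e1
    rw [← h2] at e2
    rw [e1, e2]
    push_cast
    ring
  · have e1 := height_intCast_of_ge (L := L) (a := a.val) (by omega) (by omega)
    have e2 := height_intCast_of_ge (L := L) (a := a.val + 1) (by omega) (by omega)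
    rw [← h1] at e1
    rw [← h2] at e2
    rw [e1, e2]
    push_cast
    ring

lemma abs_slope_le {L : ℕ} [NeZero L] (w : Dir) (x : Torus (2 * L)) (j : Fin 3) :
    |slope w x j| ≤ 1 := by
  rcases w.vec_eq_or j with h | h
  · have := height_add_one (x j)
    rw [slope, h, Int.cast_one, this]
    split_ifs <;> simp
  · have := height_add_one (x j - 1)
    rw [sub_add_cancel] at this
    rw [slope, h, Int.cast_neg, Int.cast_one, ← sub_eq_add_neg, this]
    split_ifs <;> simp

lemma height_second_difference {L : ℕ} [NeZero L] (a : ZMod (2 * L)) :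
    2 * height (2 * L) a - height (2 * L) (a + 1) - height (2 * L) (a - 1) =
      (if a = ((L : ℕ) : ZMod (2 * L)) then 2 else 0) - (if a = 0 then 2 else 0) := by
  have hL : 0 < L := Nat.pos_of_ne_zero (NeZero.ne L)
  have h1 := height_add_one a
  have h2 := height_add_one (a - 1)
  rw [sub_add_cancel] at h2
  have hlt : a.val < 2 * L := ZMod.val_lt a
  have hLv : ((L : ℕ) : ZMod (2 * L)).val = L := by
    rw [ZMod.val_natCast, Nat.mod_eq_of_lt (by omega)]
  have h0 : a = 0 ↔ a.val = 0 := (ZMod.val_eq_zero a).symm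
  have h3 : a = ((L : ℕ) : ZMod (2 * L)) ↔ a.val = L :=
    ⟨fun h => by rw [h, hLv], fun h => ZMod.val_injective (2 * L) (h.trans hLv.symm)⟩
  have h4 : (a - 1).val = if a.val = 0 then 2 * L - 1 else a.val - 1 := by
    split_ifs with h
    · have : a - 1 = ((2 * L - 1 : ℕ) : ZMod (2 * L)) := by
        rw [h0.2 h, Nat.cast_sub (by omega), ZMod.natCast_self, Nat.cast_one]
      rw [this, ZMod.val_natCast, Nat.mod_eq_of_lt (by omega)]
    · have : a - 1 = ((a.val - 1 : ℕ) : ZMod (2 * L)) := by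
        rw [Nat.cast_sub (by omega)]
        simp
      rw [this, ZMod.val_natCast, Nat.mod_eq_of_lt (by omega)]
  rw [h4] at h2
  simp only [h0, h3]
  split_ifs at * <;> first | omega | linarith

lemma Flat.of_val {L : ℕ} [NeZero L] {r : ℤ} {x : Torus (2 * L)}
    (h : ∀ j, (r ≤ (x j).val ∧ (x j).val + r ≤ L) ∨ (L + r ≤ (x j).val ∧ (x j).val + r ≤ 2 * L)) :
    Flat r x := by
  have hr : ∀ j, ∃ κ : ℝ, (κ = 1 ∨ κ = -1) ∧ ∀ a : ℤ, |a| ≤ r →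
      height (2 * L) (x j + (a : ZMod (2 * L))) = height (2 * L) (x j) + κ * a := by
    intro j
    have hx : ∀ a : ℤ, x j + (a : ZMod (2 * L)) = (((x j).val + a : ℤ) : ZMod (2 * L)) := by simp
    have hx0 : x j = (((x j).val : ℤ) : ZMod (2 * L)) := by simp
    rcases h j with h | h
    · refine ⟨1, Or.inl rfl, fun a ha => ?_⟩
      rw [abs_le] at ha
      rw [hx a, height_intCast_of_le (by omega) (by omega)]
      conv_rhs => rw [hx0]
      rw [height_intCast_of_le (by omega) (by omega)]
      push_cast
      ring
    · refine ⟨-1, Or.inr rfl, fun a ha => ?_⟩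
      rw [abs_le] at ha
      rw [hx a, height_intCast_of_ge (by omega) (by omega)]
      conv_rhs => rw [hx0]
      rw [height_intCast_of_ge (by omega) (by omega)]
      push_cast
      ring
  choose κ h1 h2 using hr
  exact ⟨κ, h1, h2⟩

lemma Flat.translate {m : ℕ} {r s : ℤ} {x : Torus m} (h : Flat (r + s) x) {p : Fin 3 → ℤ}
    (hp : Box s p) : Flat r (x + toTorus m p) := by
  obtain ⟨κ, h1, h2⟩ := h
  refine ⟨κ, h1, fun j a ha => ?_⟩
  have hpj := hp j
  have e1 := h2 j (p j + a) ((abs_add_le _ _).trans (by linarith))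
  have e2 := h2 j (p j) (by linarith [abs_nonneg a])
  push_cast at e1
  rw [Pi.add_apply, toTorus_apply, add_assoc, e1, e2]
  ring

lemma defect_term_nonneg {L : ℕ} [NeZero L] (Ψ : Torus (2 * L) → Fin 3 → ℝ) (w : Dir)
    (x : Torus (2 * L)) (j : Fin 3) :
    0 ≤ inc Ψ w x - slope w x j * (Ψ (x + toTorus (2 * L) w.vec) j - Ψ x j) := by
  have h1 : |Ψ (x + toTorus (2 * L) w.vec) j - Ψ x j| ≤ inc Ψ w x :=
    norm_le_pi_norm (Ψ (x + toTorus (2 * L) w.vec) - Ψ x) j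
  have h2 := abs_slope_le w x j
  have h3 := le_abs_self (slope w x j * (Ψ (x + toTorus (2 * L) w.vec) j - Ψ x j))
  rw [abs_mul] at h3
  have h4 := mul_le_of_le_one_left (abs_nonneg (Ψ (x + toTorus (2 * L) w.vec) j - Ψ x j)) h2
  linarith

lemma defect_term_le {L : ℕ} [NeZero L] (Ψ : Torus (2 * L) → Fin 3 → ℝ) (w : Dir)
    (x : Torus (2 * L)) (j : Fin 3) :
    inc Ψ w x - slope w x j * (Ψ (x + toTorus (2 * L) w.vec) j - Ψ x j) ≤ defect Ψ w x :=
  Finset.single_le_sum (f := fun j => inc Ψ w x -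
      slope w x j * (Ψ (x + toTorus (2 * L) w.vec) j - Ψ x j))
    (fun i _ => defect_term_nonneg Ψ w x i) (Finset.mem_univ j)

lemma defect_nonneg {L : ℕ} [NeZero L] (Ψ : Torus (2 * L) → Fin 3 → ℝ) (w : Dir)
    (x : Torus (2 * L)) : 0 ≤ defect Ψ w x :=
  Finset.sum_nonneg fun j _ => defect_term_nonneg Ψ w x j

lemma slope_eq_of_flat {m : ℕ} {R : ℤ} {x : Torus m} {κ : Fin 3 → ℝ}
    (hκ : ∀ j, ∀ a : ℤ, |a| ≤ R → height m (x j + (a : ZMod m)) = height m (x j) + κ j * a)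
    {w : Dir} {q : Fin 3 → ℤ} (h0 : Box R q) (h1 : Box R (q + w.vec)) (j : Fin 3) :
    slope w (x + toTorus m q) j = κ j * w.vec j := by
  have e1 := hκ j _ (h0 j)
  have e2 := hκ j _ (h1 j)
  rw [Pi.add_apply] at e2
  push_cast at e2
  rw [slope, Pi.add_apply, toTorus_apply, add_assoc, e1, e2]
  ring

/-- Near a flat point, the potential with its coordinates signed like the slopes of the heights is
tight up to the defect. -/
lemma tightUpTo_of_flat {L : ℕ} [NeZero L] (Ψ : Torus (2 * L) → Fin 3 → ℝ) {R : ℤ}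
    {x : Torus (2 * L)} {κ : Fin 3 → ℝ}
    (hκ : ∀ j, ∀ a : ℤ, |a| ≤ R →
      height (2 * L) (x j + (a : ZMod (2 * L))) = height (2 * L) (x j) + κ j * a) :
    TightUpTo R (fun p j => κ j * Ψ (x + toTorus (2 * L) p) j)
      (fun w p => defect Ψ w (x + toTorus (2 * L) p)) := by
  intro w q h0 h1 i j
  have key : ∀ j, (w.vec j : ℝ) * (κ j * Ψ (x + toTorus (2 * L) (q + w.vec)) j -
      κ j * Ψ (x + toTorus (2 * L) q) j) = slope w (x + toTorus (2 * L) q) j *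
        (Ψ (x + toTorus (2 * L) q + toTorus (2 * L) w.vec) j - Ψ (x + toTorus (2 * L) q) j) := by
    intro j
    rw [slope_eq_of_flat hκ h0 h1 j, map_add, ← add_assoc]
    ring
  simp only [key]
  have a1 := defect_term_nonneg Ψ w (x + toTorus (2 * L) q) i
  have a2 := defect_term_nonneg Ψ w (x + toTorus (2 * L) q) j
  have a3 := defect_term_le Ψ w (x + toTorus (2 * L) q) i
  have a4 := defect_term_le Ψ w (x + toTorus (2 * L) q) j
  rw [abs_le]
  constructor <;> linarith

lemma lineSum_comp_toTorus {m : ℕ} (e : Torus m → ℝ) (x : Torus m) (w : Fin 3 → ℤ) (s : ℕ)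
    (p : Fin 3 → ℤ) :
    lineSum (fun q => e (x + toTorus m q)) w s p = lineSum e (toTorus m w) s (x + toTorus m p) := by
  simp only [lineSum, map_add, map_nsmul, add_assoc]

lemma secondDiffBound_comp_toTorus {m : ℕ} (e : Dir → Torus m → ℝ) (x : Torus m) (v : Dir) (s : ℕ)
    (p : Fin 3 → ℤ) :
    secondDiffBound (fun w q => e w (x + toTorus m q)) id v s p =
      secondDiffBound e (toTorus m) v s (x + toTorus m p) := by
  simp only [secondDiffBound, lineSum_comp_toTorus, id, map_add, map_nsmul, add_assoc]

lemma sum_lineSum {m : ℕ} [NeZero m] (e : Torus m → ℝ) (w : Torus m) (s : ℕ) (c : Torus m) :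
    ∑ x, lineSum e w s (x + c) = s * ∑ x, e x := by
  simp only [lineSum]
  rw [Finset.sum_comm]
  have : ∀ i ∈ Finset.range s, ∑ x, e (x + c + i • w) = ∑ x, e x := by
    intro i _
    simp only [add_assoc]
    exact Equiv.sum_comp (Equiv.addRight (c + i • w)) e
  rw [Finset.sum_congr rfl this]
  simp

lemma sum_secondDiffBound {m : ℕ} [NeZero m] (e : Dir → Torus m → ℝ) (c : (Fin 3 → ℤ) → Torus m)
    (v : Dir) (s : ℕ) (d : Torus m) :
    ∑ x, secondDiffBound e c v s (x + d) =
      s * (3 * ∑ x, e v x + ∑ j, ∑ x, e (Dir.flip j v) x) := by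
  simp only [secondDiffBound, ← Finset.sum_div, Finset.sum_add_distrib]
  simp only [add_assoc, sum_lineSum, Fin.sum_univ_three]
  ring

lemma secondDiffBound_nonneg {M : Type*} [AddCommMonoid M] {e : Dir → M → ℝ}
    (he : ∀ w x, 0 ≤ e w x) (c : (Fin 3 → ℤ) → M) (v : Dir) (s : ℕ) (p : M) :
    0 ≤ secondDiffBound e c v s p := by
  have h : ∀ w a b, 0 ≤ lineSum (e w) a s b := fun w a b => Finset.sum_nonneg fun _ _ => he _ _
  refine div_nonneg ?_ two_pos.le
  repeat' apply add_nonneg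
  all_goals apply h

/-! ### The defect of potentials with few values -/

lemma sum_dyadicVariation_le {ι : Type*} (B : Finset ι) (f : ι → ℕ → ℝ) (C : ℝ) (K : ℕ)
    (h : ∀ k a, a + 2 ^ (k + 1) ≤ 2 ^ K →
      ∑ x ∈ B, |f x (a + 2 ^ (k + 1)) - 2 * f x (a + 2 ^ k) + f x a| ≤ C * 2 ^ k)
    (k a : ℕ) (ha : a + 2 ^ k ≤ 2 ^ K) :
    ∑ x ∈ B, dyadicVariation (f x) k a ≤ C * k * 2 ^ k / 2 := by
  induction k generalizing a with
  | zero => simp [dyadicVariation]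
  | succ k ih =>
    have hp : 0 < 2 ^ k := by positivity
    have h1 := ih a (by omega)
    have h2 := ih (a + 2 ^ k) (by omega)
    have h3 := h k a ha
    simp only [dyadicVariation, Finset.sum_add_distrib]
    refine (add_le_add (add_le_add h3 h1) h2).trans (le_of_eq ?_)
    push_cast
    ring

open Classical in
/-- Lines in one direction: along most dyadic intervals a potential with few values has a second
difference as large as its increment, while the parallelograms bound the second differences by the
defect. So the increments at the flat points are controlled by the defect. -/
lemma sum_inc_flat_le {L : ℕ} [NeZero L] (Ψ : Torus (2 * L) → Fin 3 → ℝ) {N : ℕ} (hN : 0 < N)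
    (hcard : (Finset.univ.image Ψ).card ≤ N) (v : Dir) :
    ∑ x with Flat (8 * 2 ^ (2 * N)) x, inc Ψ v x ≤
      6 * ∑ x, defect Ψ v x + ∑ j, ∑ x, defect Ψ (Dir.flip j v) x := by
  set K := 2 * N with hK
  set S : ℕ := 2 ^ K with hS
  set V := toTorus (2 * L) v.vec with hV
  set B : Finset (Torus (2 * L)) := Finset.univ.filter (Flat (7 * 2 ^ K)) with hB
  set D := ∑ x, defect Ψ v x with hD
  set C := 3 * D + ∑ j, ∑ x, defect Ψ (Dir.flip j v) x with hC
  have hSpos : (0 : ℝ) < S := by positivity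
  have hflat : ∀ x : Torus (2 * L), ∃ κ : Fin 3 → ℝ, Flat (7 * 2 ^ K) x →
      (∀ j, κ j = 1 ∨ κ j = -1) ∧ ∀ j, ∀ a : ℤ, |a| ≤ 7 * 2 ^ K →
      height (2 * L) (x j + (a : ZMod (2 * L))) = height (2 * L) (x j) + κ j * a := by
    intro x
    by_cases hx : Flat (7 * 2 ^ K) x
    · obtain ⟨κ, h1, h2⟩ := hx
      exact ⟨κ, fun _ => ⟨h1, h2⟩⟩
    · exact ⟨0, fun h => absurd h hx⟩
  choose κ hκ using hflat
  have hv0 : (v.vec 0 : ℝ) = 1 ∨ (v.vec 0 : ℝ) = -1 := by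
    rcases v.vec_eq_or 0 with h | h <;> simp [h]
  have hvabs : |(v.vec 0 : ℝ)| = 1 := by rcases hv0 with h | h <;> simp [h]
  have hbox : ∀ i : ℕ, Box i (i • v.vec) := by
    intro i j
    rcases v.vec_eq_or j with h | h <;> simp [h]
  have hbox' : ∀ (i : ℕ) (R : ℤ), i ≤ R → Box R (i • v.vec) := fun i R h j => (hbox i j).trans h
  let f : Torus (2 * L) → ℕ → ℝ := fun x i => v.vec 0 * (κ x 0 * Ψ (x + i • V) 0)
  have hSZ : ((S : ℕ) : ℤ) = 2 ^ K := by simp [hS]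
  -- On a line that starts in `B`, of length `S`, all steps are in the region where the slopes of
  -- the heights are constant, and `f` is signed so that its increments should be positive.
  have hstep : ∀ x ∈ B, ∀ i < S, f x (i + 1) - f x i =
      slope v (x + i • V) 0 * (Ψ (x + i • V + V) 0 - Ψ (x + i • V) 0) := by
    intro x hx i hi
    have h2 := (hκ x (Finset.mem_filter.1 hx).2).2
    have hi' : (i : ℤ) + 1 ≤ S := by exact_mod_cast hi
    have e := slope_eq_of_flat (w := v) (q := i • v.vec) h2 (hbox' _ _ (by omega))
      (by rw [← succ_nsmul]; exact hbox' _ _ (by push_cast; omega)) 0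
    rw [map_nsmul, ← hV] at e
    simp only [f, e, succ_nsmul, add_assoc]
    ring
  have hstep1 : ∀ x ∈ B, ∀ i < S, |f x (i + 1) - f x i| ≤ inc Ψ v (x + i • V) := by
    intro x hx i hi
    rw [hstep x hx i hi, abs_mul]
    have h1 : |Ψ (x + i • V + V) 0 - Ψ (x + i • V) 0| ≤ inc Ψ v (x + i • V) :=
      norm_le_pi_norm (Ψ (x + i • V + V) - Ψ (x + i • V)) 0
    exact (mul_le_of_le_one_left (abs_nonneg _) (abs_slope_le _ _ _)).trans h1
  have hstep2 : ∀ x ∈ B, ∀ i < S, inc Ψ v (x + i • V) - (f x (i + 1) - f x i) ≤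
      defect Ψ v (x + i • V) := by
    intro x hx i hi
    rw [hstep x hx i hi]
    exact defect_term_le Ψ v _ 0
  -- The one-dimensional inequality: the values of `f x` are images of the at most `N` values of
  -- `Ψ`.
  have hline : ∀ x ∈ B, ((K : ℝ) - N) * (lineSum (inc Ψ v) V S x - lineSum (defect Ψ v) V S x) ≤
      dyadicVariation (f x) K 0 + K * lineSum (defect Ψ v) V S x := by
    intro x hx
    have hNK : N ≤ K := by omega
    have hcf : (Finset.image (f x) (Finset.range (2 ^ K + 1))).card ≤ N := by
      refine le_trans ?_ hcard
      have hsub : Finset.image (f x) (Finset.range (2 ^ K + 1)) ⊆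
          (Finset.univ.image Ψ).image fun y => v.vec 0 * (κ x 0 * y 0) := by
        intro y hy
        obtain ⟨i, -, rfl⟩ := Finset.mem_image.1 hy
        exact Finset.mem_image_of_mem _ (Finset.mem_image_of_mem Ψ (Finset.mem_univ (x + i • V)))
      exact (Finset.card_le_card hsub).trans Finset.card_image_le
    have h1 := le_dyadicVariation (f x) K N hcf hNK
    have h2 : lineSum (inc Ψ v) V S x - lineSum (defect Ψ v) V S x ≤ f x (2 ^ K) - f x 0 := by
      rw [← Finset.sum_range_sub (f x) (2 ^ K), lineSum, lineSum, ← Finset.sum_sub_distrib]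
      refine Finset.sum_le_sum fun i hi => ?_
      have := hstep2 x hx i (Finset.mem_range.1 hi)
      linarith
    have h3 : ∑ i ∈ Finset.range (2 ^ K), (|f x (i + 1) - f x i| - (f x (i + 1) - f x i)) ≤
        lineSum (defect Ψ v) V S x := by
      refine Finset.sum_le_sum fun i hi => ?_
      have a1 := hstep1 x hx i (Finset.mem_range.1 hi)
      have a2 := hstep2 x hx i (Finset.mem_range.1 hi)
      linarith
    have h4 : (N : ℝ) ≤ K := by exact_mod_cast hNK
    have h5 := mul_le_mul_of_nonneg_left h2 (by linarith : (0 : ℝ) ≤ K - N)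
    have h6 := mul_le_mul_of_nonneg_left h3 (Nat.cast_nonneg (α := ℝ) K)
    linarith
  -- The parallelograms stay within distance `S + 3 * 2 ^ k ≤ 7 * S` of the start of the line.
  have hsecond : ∀ k a, a + 2 ^ (k + 1) ≤ 2 ^ K →
      ∑ x ∈ B, |f x (a + 2 ^ (k + 1)) - 2 * f x (a + 2 ^ k) + f x a| ≤ C * 2 ^ k := by
    intro k a hka
    have hx : ∀ x ∈ B, |f x (a + 2 ^ (k + 1)) - 2 * f x (a + 2 ^ k) + f x a| ≤
        secondDiffBound (defect Ψ) (toTorus (2 * L)) v (2 ^ k) (x + a • V) := by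
      intro x hx
      have h2 := (hκ x (Finset.mem_filter.1 hx).2).2
      have ht := tightUpTo_of_flat Ψ h2
      have hk : 2 ^ (k + 1) = 2 ^ k + 2 ^ k := by ring
      have e := ht.abs_secondDiff_le v (a • v.vec) (2 ^ k) (hbox' _ _ (by
        have : ((a + (2 ^ k + 2 ^ k) : ℕ) : ℤ) ≤ ((2 ^ K : ℕ) : ℤ) := by
          exact_mod_cast (hk ▸ hka)
        push_cast at this ⊢
        have h0 : (0 : ℤ) ≤ 2 ^ k := by positivity
        have h1 : (0 : ℤ) ≤ a := by positivity
        linarith))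
      rw [secondDiffBound_comp_toTorus, map_nsmul, ← hV] at e
      refine le_of_eq_of_le ?_ e
      rw [hk, ← add_assoc]
      simp only [f, ← add_nsmul, map_nsmul]
      rw [← hV, ← one_mul |κ x 0 * _ - _ + _|, ← hvabs, ← abs_mul]
      congr 1
      ring
    refine (Finset.sum_le_sum hx).trans ?_
    refine (Finset.sum_le_univ_sum_of_nonneg fun x => secondDiffBound_nonneg
      (fun w x => defect_nonneg Ψ w x) _ _ _ _).trans (le_of_eq ?_)
    rw [sum_secondDiffBound]
    push_cast
    ring
  have hdyadic := sum_dyadicVariation_le B f C K hsecond K 0 (by simp)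
  -- Every flat point lies on `S` of the lines.
  have hmass : S * ∑ x with Flat (8 * 2 ^ (2 * N)) x, inc Ψ v x ≤
      ∑ x ∈ B, lineSum (inc Ψ v) V S x := by
    simp only [lineSum]
    rw [Finset.sum_comm, ← nsmul_eq_mul, ← Finset.card_range S, ← Finset.sum_const,
      Finset.card_range]
    refine Finset.sum_le_sum fun i hi => ?_
    have h1 : ∑ x ∈ B, inc Ψ v (x + i • V) =
        ∑ y ∈ B.map (Equiv.addRight (i • V)).toEmbedding, inc Ψ v y := by
      rw [Finset.sum_map]
      rfl
    rw [h1]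
    refine Finset.sum_le_sum_of_subset_of_nonneg ?_ fun _ _ _ => norm_nonneg _
    intro y hy
    rw [Finset.mem_map_equiv, hB, Finset.mem_filter]
    refine ⟨Finset.mem_univ _, ?_⟩
    have hy := (Finset.mem_filter.1 hy).2
    have hi' : (i : ℤ) ≤ 2 ^ K := by
      rw [← hSZ]
      exact_mod_cast (Finset.mem_range.1 hi).le
    have h8 : (8 * 2 ^ (2 * N) : ℤ) = 7 * 2 ^ K + 2 ^ K := by rw [← hK]; ring
    rw [h8] at hy
    have := hy.translate (p := -(i • v.vec)) (fun j => by
      rw [Pi.neg_apply, abs_neg]; exact hbox' i _ hi' j)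
    rw [map_neg, map_nsmul, ← hV, ← sub_eq_add_neg] at this
    simpa [sub_eq_add_neg] using this
  have hdef : ∑ x ∈ B, lineSum (defect Ψ v) V S x ≤ S * D := by
    refine (Finset.sum_le_univ_sum_of_nonneg fun x => Finset.sum_nonneg fun i _ =>
      defect_nonneg Ψ v _).trans (le_of_eq ?_)
    have := sum_lineSum (defect Ψ v) V S 0
    simp only [add_zero] at this
    exact this
  have hsum := Finset.sum_le_sum hline
  rw [← Finset.mul_sum, Finset.sum_sub_distrib, Finset.sum_add_distrib, ← Finset.mul_sum] at hsum
  have hNpos : (0 : ℝ) < N := by exact_mod_cast hN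
  have hKN : (K : ℝ) = 2 * N := by simp [hK]
  have hSr : (2 : ℝ) ^ K = S := by simp [hS]
  rw [hSr, hKN] at hdyadic
  rw [hKN] at hsum
  set X := ∑ x with Flat (8 * 2 ^ (2 * N)) x, inc Ψ v x
  have hfin : (N * S : ℝ) * X ≤ (N * S : ℝ) * (C + 3 * D) := by
    have h1 := mul_le_mul_of_nonneg_left hmass hNpos.le
    have h2 := mul_le_mul_of_nonneg_left hdef hNpos.le
    nlinarith
  have := le_of_mul_le_mul_left hfin (by positivity)
  rw [hC] at this
  linarith

lemma Dir.flip_flip (j : Fin 3) (v : Dir) : Dir.flip j (Dir.flip j v) = v := by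
  ext i
  simp only [Dir.flip]
  split_ifs <;> simp

open Classical in
/-- The total increment of a potential with few values over the flat part of the torus is at most a
constant times its total defect. -/
lemma sum_sum_inc_flat_le {L : ℕ} [NeZero L] (Ψ : Torus (2 * L) → Fin 3 → ℝ) {N : ℕ} (hN : 0 < N)
    (hcard : (Finset.univ.image Ψ).card ≤ N) :
    ∑ v, ∑ x with Flat (8 * 2 ^ (2 * N)) x, inc Ψ v x ≤ 9 * ∑ v, ∑ x, defect Ψ v x := by
  refine (Finset.sum_le_sum fun v _ => sum_inc_flat_le Ψ hN hcard v).trans (le_of_eq ?_)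
  have hc : ∑ v, ∑ j, ∑ x, defect Ψ (Dir.flip j v) x = ∑ j, ∑ v, ∑ x, defect Ψ (Dir.flip j v) x :=
    Finset.sum_comm
  rw [Finset.sum_add_distrib, ← Finset.mul_sum, hc]
  have : ∀ j, ∑ v, ∑ x, defect Ψ (Dir.flip j v) x = ∑ v, ∑ x, defect Ψ v x := fun j =>
    Equiv.sum_comp (⟨Dir.flip j, Dir.flip j, Dir.flip_flip j, Dir.flip_flip j⟩ : Dir ≃ Dir)
      (fun v => ∑ x, defect Ψ v x)
  simp only [this]
  simp
  ring

/-- Summation by parts: the heights are harmonic away from the planes where they are extremal. -/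
lemma sum_slope_mul {L : ℕ} [NeZero L] (ψ : Torus (2 * L) → ℝ) (j : Fin 3) :
    ∑ v, ∑ x, slope v x j * (ψ (x + toTorus (2 * L) v.vec) - ψ x) =
      16 * (∑ x with x j = ((L : ℕ) : ZMod (2 * L)), ψ x - ∑ x with x j = 0, ψ x) := by
  have hv : ∀ v : Dir, ∑ x, slope v x j * (ψ (x + toTorus (2 * L) v.vec) - ψ x) =
      2 * (∑ x with x j = ((L : ℕ) : ZMod (2 * L)), ψ x - ∑ x with x j = 0, ψ x) := by
    intro v
    have h1 : ∑ x, slope v x j * ψ (x + toTorus (2 * L) v.vec) =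
        ∑ x, slope v (x - toTorus (2 * L) v.vec) j * ψ x := by
      rw [← Equiv.sum_comp (Equiv.addRight (toTorus (2 * L) v.vec))
        (fun x => slope v (x - toTorus (2 * L) v.vec) j * ψ x)]
      simp
    have h2 : ∀ x : Torus (2 * L), slope v (x - toTorus (2 * L) v.vec) j - slope v x j =
        (if x j = ((L : ℕ) : ZMod (2 * L)) then 2 else 0) - (if x j = 0 then 2 else 0) := by
      intro x
      rw [← height_second_difference]
      simp only [slope, Pi.sub_apply, toTorus_apply, sub_add_cancel]
      rcases v.vec_eq_or j with h | h <;> rw [h] <;> push_cast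
      · ring
      · rw [sub_neg_eq_add, ← sub_eq_add_neg]
        ring
    simp only [mul_sub, Finset.sum_sub_distrib]
    rw [h1, ← Finset.sum_sub_distrib]
    simp only [← sub_mul, h2]
    simp only [sub_mul, Finset.sum_sub_distrib, ite_mul, zero_mul, ← Finset.sum_filter,
      ← Finset.mul_sum]
  rw [Finset.sum_congr rfl fun v _ => hv v, Finset.sum_const, Finset.card_univ]
  have : Fintype.card Dir = 8 := by simp [Dir]
  rw [this]
  ring

/-- The value of the `j`-th coordinate on the plane to which the terminal `(j, b)` is attached. -/
def plane (L : ℕ) (b : Bool) : ZMod (2 * L) := if b then ((L : ℕ) : ZMod (2 * L)) else 0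

lemma card_filter_apply_eq {m : ℕ} [NeZero m] (j : Fin 3) (P : ZMod m → Prop) [DecidablePred P] :
    (Finset.univ.filter fun x : Torus m => P (x j)).card =
      (Finset.univ.filter P).card * m ^ 2 := by
  have h : (Finset.univ.filter fun x : Torus m => P (x j)) =
      Fintype.piFinset fun i => if i = j then Finset.univ.filter P else Finset.univ := by
    ext x
    simp only [Finset.mem_filter, Finset.mem_univ, true_and, Fintype.mem_piFinset]
    constructor
    · intro h i
      split_ifs with hi
      · subst hi; simpa using h
      · simp
    · intro h
      simpa using h j
  rw [h, Fintype.card_piFinset, Fin.prod_univ_three]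
  fin_cases j <;> simp [ZMod.card] <;> ring

open Classical in
/-- The capacity of the edges of the torus: a little more near the planes where a height is
extremal. The numbers are chosen so that the weighted length of a potential is `27` times its length
minus the length in the flat part, and the latter is at most `9` times the defect. -/
noncomputable def interiorCap (L N : ℕ) (x : Torus (2 * L)) : ℕ :=
  if Flat (8 * 2 ^ (2 * N)) x then 26 else 27

open Classical in
/-- The capacity-weighted length of a potential with at most `N` values, compared with the distances
between the three pairs of terminals. The heights, which have more values, violate this inequality
by a constant factor. -/
theorem le_weighted_sum {L : ℕ} [NeZero L] (Ψ : Torus (2 * L) → Fin 3 → ℝ) {N : ℕ} (hN : 0 < N)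
    (hcard : (Finset.univ.image Ψ).card ≤ N) (t : Fin 3 → Bool → ℝ) :
    144 * ((2 * L : ℕ) : ℝ) ^ 2 * ∑ j, (t j true - t j false) ≤
      ∑ v, ∑ x, (interiorCap L N x : ℝ) * inc Ψ v x +
        ∑ j, ∑ b, ∑ x with x j = plane L b, 144 * |Ψ x j - t j b| := by
  set D := ∑ v, ∑ x, defect Ψ v x with hD
  set I := ∑ v, ∑ x, inc Ψ v x with hI
  set F := ∑ v, ∑ x with Flat (8 * 2 ^ (2 * N)) x, inc Ψ v x with hF
  set Y := ∑ j, (∑ x with x j = plane L true, Ψ x j - ∑ x with x j = plane L false, Ψ x j) with hY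
  have h1 : F ≤ 9 * D := sum_sum_inc_flat_le Ψ hN hcard
  have h2 : D = 3 * I - 16 * Y := by
    have e : D = ∑ j, ∑ v, ∑ x, (inc Ψ v x -
        slope v x j * (Ψ (x + toTorus (2 * L) v.vec) j - Ψ x j)) := by
      simp only [hD, defect]
      refine (Finset.sum_congr rfl fun v _ => ?_).trans Finset.sum_comm
      exact Finset.sum_comm
    rw [e]
    simp only [Finset.sum_sub_distrib]
    have := fun j => sum_slope_mul (fun x => Ψ x j) j
    simp only [this, hY, plane]
    simp [Finset.mul_sum, ← hI, mul_sub]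
  have h3 : ∑ v, ∑ x, (interiorCap L N x : ℝ) * inc Ψ v x = 27 * I - F := by
    rw [hI, hF, Finset.mul_sum, ← Finset.sum_sub_distrib]
    refine Finset.sum_congr rfl fun v _ => ?_
    rw [Finset.mul_sum, Finset.sum_filter, ← Finset.sum_sub_distrib]
    refine Finset.sum_congr rfl fun x _ => ?_
    simp only [interiorCap]
    split_ifs <;> push_cast <;> ring
  have hcardp : ∀ j b, ((Finset.univ.filter fun x : Torus (2 * L) => x j = plane L b).card : ℝ) =
      ((2 * L : ℕ) : ℝ) ^ 2 := by
    intro j b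
    rw [card_filter_apply_eq j (fun a => a = plane L b), Finset.filter_eq' Finset.univ]
    simp
  have h4 : ∀ j, (∑ x with x j = plane L false, Ψ x j) - ((2 * L : ℕ) : ℝ) ^ 2 * t j false +
      (((2 * L : ℕ) : ℝ) ^ 2 * t j true - ∑ x with x j = plane L true, Ψ x j) ≤
      ∑ b, ∑ x with x j = plane L b, |Ψ x j - t j b| := by
    intro j
    rw [Fintype.sum_bool, add_comm]
    refine add_le_add ?_ ?_
    · rw [← hcardp j true, ← nsmul_eq_mul, ← Finset.sum_const, ← Finset.sum_sub_distrib]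
      exact Finset.sum_le_sum fun x _ => by rw [abs_sub_comm]; exact le_abs_self _
    · rw [← hcardp j false, ← nsmul_eq_mul, ← Finset.sum_const, ← Finset.sum_sub_distrib]
      exact Finset.sum_le_sum fun x _ => le_abs_self _
  have h5 := Finset.sum_le_sum fun (j : Fin 3) (_ : j ∈ Finset.univ) => h4 j
  simp only [Finset.sum_add_distrib, Finset.sum_sub_distrib, ← Finset.mul_sum] at h5 hY ⊢
  rw [h3]
  linarith

/-! ### Walks, paths and distances in a multigraph -/

section Walks

variable {V E : Type*} {G : Graph V E}

lemma Walk.exists_suffix {u v x : V} (p : Walk G u v) (hx : x ∈ p.support) :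
    ∃ q : Walk G x v, q.support <:+ p.support ∧ q.edges <:+ p.edges := by
  induction p with
  | nil hu =>
    simp only [Walk.support, List.mem_singleton] at hx
    subst hx
    exact ⟨.nil hu, List.suffix_rfl, List.suffix_rfl⟩
  | @cons u v w e h p ih =>
    simp only [Walk.support, List.mem_cons] at hx
    by_cases hxu : x = u
    · subst hxu
      exact ⟨.cons e h p, List.suffix_rfl, List.suffix_rfl⟩
    · obtain ⟨q, h1, h2⟩ := ih (hx.resolve_left hxu)
      exact ⟨q, h1.trans (List.suffix_cons _ _), h2.trans (List.suffix_cons _ _)⟩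

lemma Walk.start_mem_support {u v : V} (p : Walk G u v) : u ∈ p.support := by
  cases p <;> simp [Walk.support]

lemma Walk.left_mem_support {u v x y : V} {e : E} (p : Walk G u v) (he : e ∈ p.edges)
    (h : G.IsLink e x y) : x ∈ p.support := by
  induction p with
  | nil hu => simp [Walk.edges] at he
  | @cons u v w f hf p ih =>
    simp only [Walk.edges, List.mem_cons] at he
    simp only [Walk.support, List.mem_cons]
    rcases he with rfl | he
    · rcases h.left_eq_or_eq hf with rfl | rfl
      · exact Or.inl rfl
      · exact Or.inr p.start_mem_support
    · exact Or.inr (ih he)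

open Classical in
/-- The total length of the edges of a path is at least the difference of a Lipschitz potential
between its ends. -/
lemma Walk.abs_potential_sub_le [Fintype E] {ℓ : E → ℝ} {φ : V → ℝ}
    (hφ : ∀ e x y, G.IsLink e x y → |φ x - φ y| ≤ ℓ e) {u v : V} (p : Walk G u v)
    (hp : p.support.Nodup) : |φ u - φ v| ≤ ∑ e, if e ∈ p.edges then ℓ e else 0 := by
  induction p with
  | nil hu => simp [Walk.edges]
  | @cons u v w e h p ih =>
    simp only [Walk.support, List.nodup_cons] at hp
    have h1 := ih hp.2
    have he : e ∉ p.edges := fun he => hp.1 (p.left_mem_support he h)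
    have h2 : ∑ f, (if f ∈ (Walk.cons e h p).edges then ℓ f else 0) =
        ℓ e + ∑ f, if f ∈ p.edges then ℓ f else 0 := by
      rw [← Finset.sum_filter, ← Finset.sum_filter]
      have : (Finset.univ.filter fun f => f ∈ (Walk.cons e h p).edges) =
          insert e (Finset.univ.filter fun f => f ∈ p.edges) := by
        ext f
        simp [Walk.edges]
      rw [this, Finset.sum_insert (by simp [he])]
    rw [h2]
    have h3 := abs_sub_le (φ u) (φ v) (φ w)
    have h4 := hφ e u v h
    linarith

/-- The length of the shortest path from `x` to `t`, truncated at `C`; in particular it is `C` if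
there is no such path. -/
noncomputable def pathDist (G : Graph V E) (l : E → ℝ) (C : ℝ) (t x : V) : ℝ :=
  sInf (insert C (Set.range fun p : Path G x t => (p.1.edges.map l).sum))

variable {l : E → ℝ} {C : ℝ}

lemma list_sum_nonneg (hl : ∀ e, 0 ≤ l e) (L : List E) : 0 ≤ (L.map l).sum :=
  List.sum_nonneg (by simpa using fun e _ => hl e)

lemma zero_mem_lowerBounds_pathDist (hl : ∀ e, 0 ≤ l e) (hC : 0 ≤ C) (t x : V) :
    0 ∈ lowerBounds (insert C (Set.range fun p : Path G x t => (p.1.edges.map l).sum)) := by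
  rintro y (rfl | ⟨p, rfl⟩)
  · exact hC
  · exact list_sum_nonneg hl _

lemma pathDist_nonneg (hl : ∀ e, 0 ≤ l e) (hC : 0 ≤ C) (t x : V) : 0 ≤ pathDist G l C t x :=
  le_csInf (Set.insert_nonempty _ _) (zero_mem_lowerBounds_pathDist hl hC t x)

lemma pathDist_self (hl : ∀ e, 0 ≤ l e) (hC : 0 ≤ C) {t : V} (ht : t ∈ G.vertexSet) :
    pathDist G l C t t = 0 := by
  refine le_antisymm (csInf_le ⟨0, zero_mem_lowerBounds_pathDist hl hC t t⟩ ?_)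
    (pathDist_nonneg hl hC t t)
  exact Or.inr ⟨⟨.nil ht, by simp [Walk.support]⟩, by simp [Walk.edges]⟩

lemma pathDist_le_add (hl : ∀ e, 0 ≤ l e) (hC : 0 ≤ C) {e : E} {u v t : V}
    (h : G.IsLink e u v) : pathDist G l C t u ≤ pathDist G l C t v + l e := by
  rw [← sub_le_iff_le_add]
  refine le_csInf (Set.insert_nonempty _ _) ?_
  rintro y (rfl | ⟨p, rfl⟩)
  · have := csInf_le ⟨0, zero_mem_lowerBounds_pathDist (G := G) hl hC t u⟩ (Set.mem_insert _ _)
    have := hl e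
    simp only [pathDist]
    linarith
  rw [sub_le_iff_le_add]
  by_cases hu : u ∈ p.1.support
  · obtain ⟨q, h1, h2⟩ := p.1.exists_suffix hu
    have h3 : pathDist G l C t u ≤ (q.edges.map l).sum :=
      csInf_le ⟨0, zero_mem_lowerBounds_pathDist hl hC t u⟩
        (Or.inr ⟨⟨q, h1.sublist.nodup p.2⟩, rfl⟩)
    obtain ⟨L, hL⟩ := h2
    have h4 := list_sum_nonneg hl L
    have h5 := hl e
    simp only [← hL, List.map_append, List.sum_append]
    linarith
  · refine csInf_le ⟨0, zero_mem_lowerBounds_pathDist hl hC t u⟩ (Or.inr ⟨⟨.cons e h p.1, ?_⟩, ?_⟩)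
    · simpa [Walk.support] using ⟨hu, p.2⟩
    · simp [Walk.edges, add_comm]

lemma abs_pathDist_sub_le (hl : ∀ e, 0 ≤ l e) (hC : 0 ≤ C) {e : E} {u v t : V}
    (h : G.IsLink e u v) : |pathDist G l C t u - pathDist G l C t v| ≤ l e := by
  rw [abs_sub_le_iff]
  have h1 := pathDist_le_add (t := t) hl hC h
  have h2 := pathDist_le_add (t := t) hl hC h.symm
  constructor <;> linarith

lemma exists_path_of_pathDist_lt {t x : V} (h : pathDist G l C t x < C) {ε : ℝ}
    (hε : 0 < ε) : ∃ p : Path G x t, (p.1.edges.map l).sum < pathDist G l C t x + ε := by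
  obtain ⟨y, hy, hlt⟩ := exists_lt_of_csInf_lt
    (s := insert C (Set.range fun p : Path G x t => (p.1.edges.map l).sum))
    (Set.insert_nonempty _ _) (b := min C (pathDist G l C t x + ε))
    (by rw [lt_min_iff]; exact ⟨h, lt_add_of_pos_right _ hε⟩)
  rcases hy with rfl | ⟨p, rfl⟩
  · exact absurd (hlt.trans_le (min_le_left _ _)) (lt_irrefl _)
  · exact ⟨p, hlt.trans_le (min_le_right _ _)⟩

end Walks

/-! ### Linear programming duality for the congestion -/

section Duality

variable {V E K : Type*} {G : Graph V E} {τ : K → V}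

/-- The combination of two flows with coefficients `a` and `b`. -/
noncomputable def Flow.comb (a b : ℝ≥0) (F F' : Flow G τ) : Flow G τ :=
  fun s t => a • F s t + b • F' s t

lemma sum_comb {α : Type*} (a b : ℝ≥0) (f g : α →₀ ℝ≥0) (P : α → Prop) [DecidablePred P] :
    ((a • f + b • g).sum fun p x => if P p then x else 0) =
      a * (f.sum fun p x => if P p then x else 0) +
        b * (g.sum fun p x => if P p then x else 0) := by
  have h0 : ∀ p, (fun p x => if P p then x else 0 : α → ℝ≥0 → ℝ≥0) p 0 = 0 := fun p => by simp
  rw [Finsupp.sum_add_index' (h := fun p x => if P p then x else 0) h0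
    (fun p x y => by split_ifs <;> simp),
    Finsupp.sum_smul_index (h := fun p x => if P p then x else 0) h0,
    Finsupp.sum_smul_index (h := fun p x => if P p then x else 0) h0,
    Finsupp.mul_sum, Finsupp.mul_sum]
  simp only [mul_ite, mul_zero]

lemma Flow.onEdge_comb [Fintype K] (a b : ℝ≥0) (F F' : Flow G τ) (e : E) :
    (Flow.comb a b F F').onEdge e = a * F.onEdge e + b * F'.onEdge e := by
  simp only [Flow.onEdge, Flow.comb, sum_comb, Finset.sum_add_distrib, Finset.mul_sum]

lemma Flow.Routes.comb {D : Demand K} {a b : ℝ≥0} (hab : a + b = 1) {F F' : Flow G τ}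
    (hF : F.Routes D) (hF' : F'.Routes D) : (Flow.comb a b F F').Routes D := by
  intro s t hst
  have h1 := hF s t hst
  have h2 := hF' s t hst
  have h3 : ∀ s t, ((Flow.comb a b F F' s t).sum fun _ x => x) =
      a * ((F s t).sum fun _ x => x) + b * ((F' s t).sum fun _ x => x) := by
    intro s t
    have := sum_comb a b (F s t) (F' s t) (fun _ => True)
    simpa [Flow.comb] using this
  rw [h3, h3]
  calc _ = a * (((F s t).sum fun _ x => x) + ((F t s).sum fun _ x => x)) +
        b * (((F' s t).sum fun _ x => x) + ((F' t s).sum fun _ x => x)) := by ring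
    _ = D s(s, t) := by rw [h1, h2, ← add_mul, hab, one_mul]

/-- If a demand has congestion more than `c`, then there are edge lengths for which every flow that
routes it has a large total length: the separation of the loads of flows from the loads below `c`.
-/
lemma exists_lengths [Fintype K] [Fintype E] {D : Demand K} {c : ℝ} (hc : 0 < c)
    (h : ENNReal.ofReal c < congestion G τ D) :
    ∃ (l : E → ℝ) (u : ℝ), (∀ e, 0 ≤ l e) ∧ 0 < u ∧ c * ∑ e, l e ≤ u ∧
      ∀ F : Flow G τ, F.Routes D → u ≤ ∑ e, l e * F.onEdge e := by
  classical
  set A : Set (E → ℝ) := Set.univ.pi fun _ => Set.Iio c with hA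
  set B : Set (E → ℝ) := {y | ∃ F : Flow G τ, F.Routes D ∧ ∀ e, y e = F.onEdge e} with hB
  have hA1 : Convex ℝ A := convex_pi fun _ _ => convex_Iio c
  have hA2 : IsOpen A := isOpen_set_pi Set.finite_univ fun _ _ => isOpen_Iio
  have hB1 : Convex ℝ B := by
    rintro y ⟨F, hF, hy⟩ y' ⟨F', hF', hy'⟩ a b ha hb hab
    lift a to ℝ≥0 using ha
    lift b to ℝ≥0 using hb
    refine ⟨Flow.comb a b F F', hF.comb (by exact_mod_cast hab) hF', fun e => ?_⟩
    rw [Flow.onEdge_comb]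
    simp [hy, hy']
  have hdisj : Disjoint A B := by
    rw [Set.disjoint_left]
    rintro y hyA ⟨F, hF, hy⟩
    have h1 : F.congestion ≤ ENNReal.ofReal c := by
      refine iSup₂_le fun e _ => ?_
      have := hyA e (Set.mem_univ e)
      rw [Set.mem_Iio, hy] at this
      rw [← ENNReal.ofReal_coe_nnreal]
      exact ENNReal.ofReal_le_ofReal this.le
    exact absurd ((iInf₂_le F hF).trans h1) (not_le.2 h)
  obtain ⟨f, u, hfA, hfB⟩ := geometric_hahn_banach_open hA1 hA2 hB1 hdisj
  set l : E → ℝ := fun e => f fun j => if e = j then 1 else 0 with hl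
  have hf : ∀ y, f y = ∑ e, y e * l e := fun y => by
    have := LinearMap.pi_apply_eq_sum_univ f.toLinearMap y
    simpa using this
  have hu : 0 < u := by
    have := hfA 0 (fun e _ => hc)
    simpa using this
  have hl0 : ∀ e, 0 ≤ l e := by
    intro e
    by_contra hneg
    push Not at hneg
    have hk : 0 ≤ u / -l e := div_nonneg hu.le (by linarith)
    have := hfA (fun j => if e = j then -(u / -l e) else 0) (fun j _ => by
      simp only [Set.mem_Iio]
      split_ifs <;> linarith)
    rw [hf] at this
    simp only [ite_mul, zero_mul, Finset.sum_ite_eq, Finset.mem_univ, if_true] at this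
    have h2 : -(u / -l e) * l e = u := by
      rw [neg_mul, ← mul_neg, div_mul_cancel₀ _ (by linarith)]
    linarith
  refine ⟨l, u, hl0, hu, ?_, fun F hF => ?_⟩
  · by_contra hlt
    push Not at hlt
    have hs : 0 < ∑ e, l e := by
      by_contra hs
      push Not at hs
      have := mul_nonpos_of_nonneg_of_nonpos hc.le hs
      linarith
    have := hfA (fun _ => u / ∑ e, l e) (fun _ _ => by
      rw [Set.mem_Iio, div_lt_iff₀ hs]
      exact hlt)
    rw [hf, ← Finset.mul_sum, div_mul_cancel₀ _ hs.ne'] at this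
    exact lt_irrefl _ this
  · have := hfB (fun e => F.onEdge e) ⟨F, hF, fun _ => rfl⟩
    rw [hf] at this
    simpa only [mul_comm] using this

open Classical in
/-- The demand of one unit for every unordered pair that is related by `A` in one of its two orders.
-/
noncomputable def unitDemand (A : K → K → Prop) : Demand K :=
  fun z => if ∃ a b, A a b ∧ z = s(a, b) then 1 else 0

lemma unitDemand_mk (A : K → K → Prop) [DecidableRel A] (a b : K) :
    unitDemand A s(a, b) = if A a b ∨ A b a then 1 else 0 := by
  classical
  rw [unitDemand]
  congr 1
  rw [eq_iff_iff]
  constructor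
  · rintro ⟨c, d, h, hz⟩
    rcases Sym2.eq_iff.1 hz with ⟨rfl, rfl⟩ | ⟨rfl, rfl⟩
    · exact Or.inl h
    · exact Or.inr h
  · rintro (h | h)
    · exact ⟨a, b, h, rfl⟩
    · exact ⟨b, a, h, Sym2.eq_swap⟩

open Classical in
/-- The flow that sends one unit along a given path for every pair related by `A`. -/
noncomputable def Flow.ofPaths (A : K → K → Prop) (P : ∀ a b, A a b → Path G (τ a) (τ b)) :
    Flow G τ :=
  fun a b => if h : A a b then Finsupp.single (P a b h) 1 else 0

lemma Flow.ofPaths_routes {A : K → K → Prop} (hA : ∀ a b, A a b → ¬ A b a)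
    (P : ∀ a b, A a b → Path G (τ a) (τ b)) : (Flow.ofPaths A P).Routes (unitDemand A) := by
  classical
  intro a b _
  have h : ∀ a b, ((Flow.ofPaths A P a b).sum fun _ x => x) = if A a b then 1 else 0 := by
    intro a b
    simp only [Flow.ofPaths]
    split_ifs <;> simp
  rw [h, h, unitDemand_mk]
  have := hA a b
  by_cases h1 : A a b <;> by_cases h2 : A b a <;> simp_all

open Classical in
lemma Flow.sum_mul_onEdge_ofPaths_le [Fintype K] [Fintype E] {A : K → K → Prop} {l : E → ℝ}
    (hl : ∀ e, 0 ≤ l e)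
    (P : ∀ a b, A a b → Path G (τ a) (τ b)) {g : K → K → ℝ}
    (hg : ∀ a b h, ((P a b h).1.edges.map l).sum ≤ g a b) :
    ∑ e, l e * (Flow.ofPaths A P).onEdge e ≤ ∑ a, ∑ b, if A a b then g a b else 0 := by
  have h1 : ∀ e, ((Flow.ofPaths A P).onEdge e : ℝ) =
      ∑ a, ∑ b, if h : A a b then (if e ∈ (P a b h).1.edges then 1 else 0) else 0 := by
    intro e
    simp only [Flow.onEdge, NNReal.coe_sum]
    refine Finset.sum_congr rfl fun a _ => Finset.sum_congr rfl fun b _ => ?_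
    simp only [Flow.ofPaths]
    by_cases h : A a b
    · by_cases h' : e ∈ (P a b h).1.edges <;> simp [h, h']
    · simp [h]
  simp only [h1, Finset.mul_sum]
  rw [Finset.sum_comm]
  refine Finset.sum_le_sum fun a _ => ?_
  rw [Finset.sum_comm]
  refine Finset.sum_le_sum fun b _ => ?_
  split_ifs with h
  · refine le_trans ?_ (hg a b h)
    simp only [mul_ite, mul_one, mul_zero]
    rw [← Finset.sum_filter]
    have : (Finset.univ.filter fun e => e ∈ (P a b h).1.edges) = (P a b h).1.edges.toFinset := by
      ext e; simp
    rw [this]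
    generalize (P a b h).1.edges = L
    induction L with
    | nil => simp
    | cons e L ih =>
      rw [List.toFinset_cons, List.map_cons, List.sum_cons]
      by_cases he : e ∈ L.toFinset
      · rw [Finset.insert_eq_of_mem he]
        linarith [hl e]
      · rw [Finset.sum_insert he]
        linarith
  · simp

open Classical in
/-- The congestion of a unit demand is at most `c` if, for all edge lengths, the total length is
large compared with the sum of the distances between the pairs with demand. -/
lemma congestion_unitDemand_le [Fintype K] [Fintype E] {A : K → K → Prop}
    (hA : ∀ a b, A a b → ¬ A b a)
    (hτ : ∀ a, τ a ∈ G.vertexSet) {M c : ℝ} (hM : 0 < M) (hc : 0 < c) (hMc : 1 < M * c)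
    (h : ∀ (l : E → ℝ) (φ : K → V → ℝ), (∀ e, 0 ≤ l e) →
      (∀ b e x y, G.IsLink e x y → |φ b x - φ b y| ≤ l e) →
      M * ∑ a, ∑ b, (if A a b then φ b (τ a) - φ b (τ b) else 0) ≤ ∑ e, l e) :
    congestion G τ (unitDemand A) ≤ ENNReal.ofReal c := by
  by_contra hlt
  push Not at hlt
  obtain ⟨l, u, hl, hu, hcu, hF⟩ := exists_lengths hc hlt
  have hsum : 0 ≤ ∑ e, l e := Finset.sum_nonneg fun e _ => hl e
  -- Truncating beyond the total length makes sure that all pairs with demand are connected.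
  set C := (∑ e, l e) / M + 1 with hC
  have hC0 : 0 ≤ C := by positivity
  set g : K → K → ℝ := fun a b => pathDist G l C (τ b) (τ a) with hg
  have hg0 : ∀ a b, 0 ≤ g a b := fun a b => pathDist_nonneg hl hC0 _ _
  have hkey := h l (fun b => pathDist G l C (τ b)) hl
    fun b e x y hxy => abs_pathDist_sub_le hl hC0 hxy
  simp only [pathDist_self hl hC0 (hτ _), sub_zero] at hkey
  change M * ∑ a, ∑ b, (if A a b then g a b else 0) ≤ _ at hkey
  set Γ := ∑ a, ∑ b, (if A a b then g a b else 0) with hΓ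
  have hterm : ∀ a b, 0 ≤ if A a b then g a b else 0 := fun a b => by
    split_ifs
    exacts [hg0 a b, le_rfl]
  have hlt : ∀ a b, A a b → g a b < C := by
    intro a b hab
    have h1 : (if A a b then g a b else 0) ≤ Γ :=
      (Finset.single_le_sum (f := fun b => if A a b then g a b else 0) (fun b _ => hterm a b)
        (Finset.mem_univ b)).trans
      (Finset.single_le_sum (f := fun a => ∑ b, if A a b then g a b else 0)
        (fun a _ => Finset.sum_nonneg fun b _ => hterm a b) (Finset.mem_univ a))
    rw [if_pos hab] at h1
    have h2 : Γ ≤ (∑ e, l e) / M := by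
      rw [le_div_iff₀ hM]
      linarith
    linarith
  have hεΓ : ∀ ε > 0, u ≤ Γ + ε * (Fintype.card K * Fintype.card K) := by
    intro ε hε
    choose P hP using fun a b hab => exists_path_of_pathDist_lt (hlt a b hab) hε
    refine (hF _ (Flow.ofPaths_routes hA P)).trans ?_
    refine (Flow.sum_mul_onEdge_ofPaths_le hl P (g := fun a b => g a b + ε)
      fun a b hab => (hP a b hab).le).trans ?_
    have h1 : ∀ a b, (if A a b then g a b + ε else 0) ≤ (if A a b then g a b else 0) + ε := by
      intro a b
      split_ifs <;> linarith
    refine (Finset.sum_le_sum fun a _ => Finset.sum_le_sum fun b _ => h1 a b).trans (le_of_eq ?_)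
    simp only [Finset.sum_add_distrib, Finset.sum_const, Finset.card_univ, nsmul_eq_mul, ← hΓ]
    ring
  have huΓ : u ≤ Γ := by
    refine le_of_forall_pos_le_add fun δ hδ => ?_
    have hpos : (0 : ℝ) < Fintype.card K * Fintype.card K + 1 := by positivity
    have := hεΓ (δ / (Fintype.card K * Fintype.card K + 1)) (by positivity)
    refine this.trans ?_
    gcongr
    rw [div_mul_eq_mul_div, div_le_iff₀ hpos]
    nlinarith
  have h1 := mul_le_mul_of_nonneg_left hkey hc.le
  nlinarith

open Classical in
/-- A Lipschitz family of potentials bounds the congestion of a unit demand from below. -/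
lemma le_congestion_unitDemand [Fintype K] [Fintype E] {A : K → K → Prop}
    (hA : ∀ a b, A a b → ¬ A b a)
    (hE : ∀ e, e ∈ G.edgeSet) {ℓ : E → ℝ} (hℓ : ∀ e, 0 ≤ ℓ e) {φ : K → V → ℝ}
    (hφ : ∀ b e x y, G.IsLink e x y → |φ b x - φ b y| ≤ ℓ e) {c : ℝ}
    (hpos : 0 < ∑ a, ∑ b, (if A a b then φ b (τ a) - φ b (τ b) else 0))
    (hc : c * ∑ e, ℓ e ≤ ∑ a, ∑ b, (if A a b then φ b (τ a) - φ b (τ b) else 0)) :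
    ENNReal.ofReal c ≤ congestion G τ (unitDemand A) := by
  refine le_iInf₂ fun F hF => ?_
  by_contra hlt
  push Not at hlt
  set d := F.congestion.toReal with hd
  have hfin : F.congestion ≠ ∞ := (hlt.trans ENNReal.ofReal_lt_top).ne
  have hdc : d < c := by
    rw [← ENNReal.ofReal_toReal hfin] at hlt
    exact (ENNReal.ofReal_lt_ofReal_iff').1 hlt |>.1
  have hon : ∀ e, (F.onEdge e : ℝ) ≤ d := by
    intro e
    have : (F.onEdge e : ℝ≥0∞) ≤ F.congestion :=
      le_iSup₂ (f := fun e (_ : e ∈ G.edgeSet) => (F.onEdge e : ℝ≥0∞)) e (hE e)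
    have h2 := ENNReal.toReal_mono hfin this
    simpa using h2
  -- `W a b` is the total length of the flow from `a` to `b`.
  set len : ∀ a b : K, Path G (τ a) (τ b) → ℝ :=
    fun a b p => ∑ e, if e ∈ p.1.edges then ℓ e else 0 with hlen
  set W : K → K → ℝ := fun a b => ∑ p ∈ (F a b).support, (F a b p : ℝ) * len a b p with hW
  have hWsum : ∑ e, ℓ e * F.onEdge e = ∑ a, ∑ b, W a b := by
    simp only [Flow.onEdge, NNReal.coe_sum, Finset.mul_sum, hW, hlen, Finsupp.sum]
    rw [Finset.sum_comm]
    refine Finset.sum_congr rfl fun a _ => ?_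
    rw [Finset.sum_comm]
    refine Finset.sum_congr rfl fun b _ => ?_
    rw [Finset.sum_comm]
    refine Finset.sum_congr rfl fun p _ => Finset.sum_congr rfl fun e _ => ?_
    split_ifs <;> simp [mul_comm]
  have hlen0 : ∀ a b p, 0 ≤ len a b p := fun a b p => Finset.sum_nonneg fun e _ => by
    split_ifs
    exacts [hℓ e, le_rfl]
  have hW0 : ∀ a b, 0 ≤ W a b := fun a b => Finset.sum_nonneg fun p _ =>
    mul_nonneg (NNReal.coe_nonneg _) (hlen0 a b p)
  have hWge : ∀ a b (δ : ℝ), (∀ p, δ ≤ len a b p) →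
      δ * (((F a b).sum fun _ x => x : ℝ≥0) : ℝ) ≤ W a b := by
    intro a b δ h
    simp only [Finsupp.sum, NNReal.coe_sum, Finset.mul_sum, hW]
    refine Finset.sum_le_sum fun p _ => ?_
    rw [mul_comm]
    exact mul_le_mul_of_nonneg_left (h p) (NNReal.coe_nonneg _)
  have hpair : ∀ a b, A a b → φ b (τ a) - φ b (τ b) ≤ W a b + W b a := by
    intro a b hab
    have hne : a ≠ b := by
      rintro rfl
      exact hA a a hab hab
    have h1 := hWge a b (φ b (τ a) - φ b (τ b)) fun p =>
      (le_abs_self _).trans (Walk.abs_potential_sub_le (hφ b) p.1 p.2)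
    have h2 := hWge b a (φ b (τ a) - φ b (τ b)) fun p => by
      refine (le_abs_self _).trans ?_
      rw [abs_sub_comm]
      exact Walk.abs_potential_sub_le (hφ b) p.1 p.2
    have h3 := hF a b hne
    rw [unitDemand_mk, if_pos (Or.inl hab)] at h3
    have h4 : ((((F a b).sum fun _ x => x) : ℝ≥0) : ℝ) +
        (((F b a).sum fun _ x => x : ℝ≥0) : ℝ) = 1 := by
      exact_mod_cast h3
    calc φ b (τ a) - φ b (τ b) = (φ b (τ a) - φ b (τ b)) *
        (((((F a b).sum fun _ x => x) : ℝ≥0) : ℝ) + (((F b a).sum fun _ x => x : ℝ≥0) : ℝ)) := by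
          rw [h4, mul_one]
      _ ≤ _ := by rw [mul_add]; exact add_le_add h1 h2
  have htot : ∑ a, ∑ b, (if A a b then φ b (τ a) - φ b (τ b) else 0) ≤ ∑ a, ∑ b, W a b := by
    have h1 : ∑ a, ∑ b, (if A a b then φ b (τ a) - φ b (τ b) else 0) ≤
        ∑ a, ∑ b, ((if A a b then W a b else 0) + (if A a b then W b a else 0)) := by
      refine Finset.sum_le_sum fun a _ => Finset.sum_le_sum fun b _ => ?_
      split_ifs with hab
      · exact hpair a b hab
      · simp
    refine h1.trans ?_
    simp only [Finset.sum_add_distrib]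
    rw [Finset.sum_comm (f := fun a b => if A a b then W b a else 0), ← Finset.sum_add_distrib]
    refine Finset.sum_le_sum fun a _ => ?_
    rw [← Finset.sum_add_distrib]
    refine Finset.sum_le_sum fun b _ => ?_
    have h3 := hW0 a b
    by_cases h1 : A a b
    · rw [if_pos h1, if_neg (hA a b h1), add_zero]
    · rw [if_neg h1, zero_add]
      split_ifs
      exacts [le_rfl, h3]
  have hle : ∑ a, ∑ b, W a b ≤ d * ∑ e, ℓ e := by
    rw [← hWsum, Finset.mul_sum]
    refine Finset.sum_le_sum fun e _ => ?_
    rw [mul_comm]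
    exact mul_le_mul_of_nonneg_right (hon e) (hℓ e)
  have hs : 0 ≤ ∑ e, ℓ e := Finset.sum_nonneg fun e _ => hℓ e
  have hs' : 0 < ∑ e, ℓ e := by
    rcases hs.eq_or_lt with h0 | h0
    · rw [← h0] at hle
      linarith
    · exact h0
  have := mul_lt_mul_of_pos_right hdc hs'
  linarith

end Duality

/-! ### The graph: a torus with three pairs of terminals -/

/-- The vertices: the terminals `(j, false)` and `(j, true)`, which form the `j`-th pair, and the
points of the torus. -/
abbrev TorusVertex (L : ℕ) : Type := (Fin 3 × Bool) ⊕ Torus (2 * L)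

/-- The classes of parallel edges: the edges of the torus, one for each point and direction, and the
edges between a terminal and a point. -/
abbrev EdgeClass (L : ℕ) : Type := (Dir × Torus (2 * L)) ⊕ (Fin 3 × Bool × Torus (2 * L))

open Classical in
/-- The number of parallel edges in a class. It is `0` for a terminal and a point outside the plane
of the terminal. -/
noncomputable def edgeCap (L N : ℕ) : EdgeClass L → ℕ
  | .inl (_, x) => interiorCap L N x
  | .inr (j, b, x) => if x j = plane L b then 144 else 0

/-- The edges. -/
abbrev TorusEdge (L N : ℕ) : Type := Σ c : EdgeClass L, Fin (edgeCap L N c)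

/-- The two ends of the edges in a class. -/
def edgeEnds (L : ℕ) : EdgeClass L → TorusVertex L × TorusVertex L
  | .inl (v, x) => (.inr x, .inr (x + toTorus (2 * L) v.vec))
  | .inr (j, b, x) => (.inl (j, b), .inr x)

/-- The torus with its terminals, as a multigraph. -/
def torusGraph (L N : ℕ) : Graph (TorusVertex L) (TorusEdge L N) where
  vertexSet := Set.univ
  IsLink e x y := (x = (edgeEnds L e.1).1 ∧ y = (edgeEnds L e.1).2) ∨
    (x = (edgeEnds L e.1).2 ∧ y = (edgeEnds L e.1).1)
  isLink_symm _ _ := ⟨fun _ _ h => h.symm.imp And.symm And.symm⟩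
  eq_or_eq_of_isLink_of_isLink := by
    rintro e x y v w (⟨rfl, rfl⟩ | ⟨rfl, rfl⟩) (⟨rfl, rfl⟩ | ⟨rfl, rfl⟩) <;> simp
  left_mem_of_isLink _ _ _ _ := Set.mem_univ _

lemma torusGraph_isLink {L N : ℕ} (e : TorusEdge L N) :
    (torusGraph L N).IsLink e (edgeEnds L e.1).1 (edgeEnds L e.1).2 := Or.inl ⟨rfl, rfl⟩

/-- The six terminals. -/
def terminals (L : ℕ) : Finset (TorusVertex L) := Finset.univ.map Function.Embedding.inl

/-- The terminal with a given name. -/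
def terminal (L : ℕ) (j : Fin 3) (b : Bool) : terminals L :=
  ⟨.inl (j, b), Finset.mem_map_of_mem _ (Finset.mem_univ _)⟩

/-- The pairs of terminals with demand. -/
def IsDemandPair (L : ℕ) (a b : terminals L) : Prop :=
  ∃ j, a = terminal L j false ∧ b = terminal L j true

lemma terminal_inj {L : ℕ} {i j : Fin 3} {b c : Bool} :
    terminal L i b = terminal L j c ↔ i = j ∧ b = c := by
  constructor
  · intro h
    have h' : (Sum.inl (i, b) : TorusVertex L) = Sum.inl (j, c) := congrArg Subtype.val h
    simpa using h'
  · rintro ⟨rfl, rfl⟩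
    rfl

lemma IsDemandPair.not_swap {L : ℕ} (a b : terminals L) (h : IsDemandPair L a b) :
    ¬ IsDemandPair L b a := by
  rintro ⟨j, rfl, rfl⟩
  obtain ⟨i, h1, -⟩ := h
  simp [terminal_inj] at h1

open Classical in
lemma sum_isDemandPair {L : ℕ} (g : terminals L → terminals L → ℝ) :
    ∑ a, ∑ b, (if IsDemandPair L a b then g a b else 0) =
      ∑ j, g (terminal L j false) (terminal L j true) := by
  have hbij : Function.Bijective fun p : Fin 3 × Bool => terminal L p.1 p.2 := by
    constructor
    · rintro ⟨i, b⟩ ⟨j, c⟩ h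
      simpa [terminal_inj] using h
    · rintro ⟨x, hx⟩
      obtain ⟨p, -, rfl⟩ := Finset.mem_map.1 hx
      exact ⟨p, rfl⟩
  have hsum : ∀ f : terminals L → ℝ, ∑ a, f a = ∑ j, ∑ b, f (terminal L j b) := by
    intro f
    rw [← Fintype.sum_prod_type', ← hbij.sum_comp]
  have hiff : ∀ i j b c, IsDemandPair L (terminal L i b) (terminal L j c) ↔
      i = j ∧ b = false ∧ c = true := by
    intro i j b c
    simp only [IsDemandPair, terminal_inj]
    constructor
    · rintro ⟨k, ⟨rfl, rfl⟩, rfl, rfl⟩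
      simp
    · rintro ⟨rfl, rfl, rfl⟩
      exact ⟨i, by simp⟩
  rw [hsum]
  simp only [hsum, hiff]
  refine Finset.sum_congr rfl fun i _ => ?_
  simp [Finset.sum_ite_eq]

lemma sum_torusEdge {L N : ℕ} [NeZero L] (f : EdgeClass L → ℝ) :
    ∑ e : TorusEdge L N, f e.1 = ∑ v, ∑ x, (interiorCap L N x : ℝ) * f (.inl (v, x)) +
      ∑ j, ∑ b, ∑ x with x j = plane L b, 144 * f (.inr (j, b, x)) := by
  classical
  rw [Fintype.sum_sigma]
  simp only [Finset.sum_const, Finset.card_univ, Fintype.card_fin, nsmul_eq_mul]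
  rw [Fintype.sum_sum_type, Fintype.sum_prod_type, Fintype.sum_prod_type]
  simp only [Fintype.sum_prod_type, edgeCap, Finset.sum_filter]
  congr 1
  refine Finset.sum_congr rfl fun j _ => Finset.sum_congr rfl fun b _ =>
    Finset.sum_congr rfl fun x _ => ?_
  split_ifs <;> simp

/-- A Lipschitz potential on the contracted graph is Lipschitz along the edges of the graph. -/
lemma abs_sub_le_of_contract {V E : Type*} {G : Graph V E} {𝓕 : Setoid V} {φ : Quotient 𝓕 → ℝ}
    {e : E} {c : ℝ} (hc : 0 ≤ c)
    (hφ : ∀ x y, (contract G 𝓕).IsLink e x y → |φ x - φ y| ≤ c) {x y : V} (h : G.IsLink e x y) :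
    |φ (Quotient.mk 𝓕 x) - φ (Quotient.mk 𝓕 y)| ≤ c := by
  by_cases hxy : Quotient.mk 𝓕 x = Quotient.mk 𝓕 y
  · simpa [hxy] using hc
  · refine hφ _ _ ⟨h.map _, ?_⟩
    rintro ⟨z, hz⟩
    have h1 := (h.map (Quotient.mk 𝓕)).left_eq_or_eq hz
    have h2 := (h.map (Quotient.mk 𝓕)).right_eq_or_eq hz
    simp only [or_self] at h1 h2
    exact hxy (h1.trans h2.symm)

/-- In every contraction to at most `N` vertices the demand can be routed with little congestion.
Any constant below the `144` of `le_weighted_sum` would do in place of `143.5`. -/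
lemma congestion_contract_le {L N : ℕ} [NeZero L] (hN : 0 < N) (𝓕 : Setoid (TorusVertex L))
    (hcard : (contract (torusGraph L N) 𝓕).vertexSet.ncard ≤ N) :
    congestion (contract (torusGraph L N) 𝓕)
      (fun t : terminals L => Quotient.mk 𝓕 (t : TorusVertex L)) (unitDemand (IsDemandPair L)) ≤
      ENNReal.ofReal (1 / (143.5 * ((2 * L : ℕ) : ℝ) ^ 2)) := by
  classical
  have hL : (0 : ℝ) < ((2 * L : ℕ) : ℝ) := by
    have := NeZero.pos L
    positivity
  have hV : (contract (torusGraph L N) 𝓕).vertexSet = Quotient.mk 𝓕 '' Set.univ := rfl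
  have hmem : ∀ x, Quotient.mk 𝓕 x ∈ (contract (torusGraph L N) 𝓕).vertexSet := fun x =>
    hV ▸ ⟨x, Set.mem_univ x, rfl⟩
  refine congestion_unitDemand_le (M := 144 * ((2 * L : ℕ) : ℝ) ^ 2) IsDemandPair.not_swap
    (fun a => hmem _) (by positivity) (by positivity) ?_ ?_
  · rw [mul_one_div, lt_div_iff₀ (by positivity), one_mul]
    have : 0 < ((2 * L : ℕ) : ℝ) ^ 2 := by positivity
    linarith
  intro l φ hl hφ
  rw [sum_isDemandPair]
  have hφ' : ∀ b e, |φ b (Quotient.mk 𝓕 (edgeEnds L e.1).1) -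
      φ b (Quotient.mk 𝓕 (edgeEnds L e.1).2)| ≤ l e := fun b e =>
    abs_sub_le_of_contract (hl e) (hφ b e) (torusGraph_isLink e)
  -- The potentials are distances to the terminals `(j, true)`, so their negatives increase towards
  -- them.
  set Ψ : Torus (2 * L) → Fin 3 → ℝ :=
    fun x j => -φ (terminal L j true) (Quotient.mk 𝓕 (.inr x)) with hΨ
  set t : Fin 3 → Bool → ℝ :=
    fun j b => -φ (terminal L j true) (Quotient.mk 𝓕 (.inl (j, b))) with ht
  have hcardΨ : (Finset.univ.image Ψ).card ≤ N := by
    refine le_trans ?_ hcard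
    have hsub : ((Finset.univ.image Ψ : Finset _) : Set (Fin 3 → ℝ)) ⊆
        (fun X j => -φ (terminal L j true) X) '' (contract (torusGraph L N) 𝓕).vertexSet := by
      intro y hy
      obtain ⟨x, -, rfl⟩ := Finset.mem_image.1 (Finset.mem_coe.1 hy)
      exact ⟨_, hmem (.inr x), rfl⟩
    have hfin : (contract (torusGraph L N) 𝓕).vertexSet.Finite := Set.toFinite _
    rw [← Set.ncard_coe_finset]
    exact (Set.ncard_le_ncard hsub (hfin.image _)).trans (Set.ncard_image_le hfin)
  have hmain := le_weighted_sum Ψ hN hcardΨ t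
  have hedge := sum_torusEdge (L := L) (N := N) (Sum.elim (fun p => inc Ψ p.1 p.2)
    (fun p => |Ψ p.2.2 p.1 - t p.1 p.2.1|))
  simp only [Sum.elim_inl, Sum.elim_inr] at hedge
  rw [← hedge] at hmain
  have hgain : ∑ j, (φ (terminal L j true) (Quotient.mk 𝓕 (terminal L j false : TorusVertex L)) -
      φ (terminal L j true) (Quotient.mk 𝓕 (terminal L j true : TorusVertex L))) =
      ∑ j, (t j true - t j false) := by
    refine Finset.sum_congr rfl fun j _ => ?_
    simp only [ht, terminal]
    ring
  rw [hgain]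
  refine hmain.trans (Finset.sum_le_sum ?_)
  rintro ⟨c | c, i⟩ _
  · simp only [Sum.elim_inl, inc]
    refine (pi_norm_le_iff_of_nonneg (hl _)).2 fun j => ?_
    have := hφ' (terminal L j true) ⟨.inl c, i⟩
    simp only [edgeEnds] at this
    rw [Pi.sub_apply, Real.norm_eq_abs]
    simp only [hΨ]
    rw [neg_sub_neg]
    exact this
  · simp only [Sum.elim_inr]
    have := hφ' (terminal L c.1 true) ⟨.inr c, i⟩
    simp only [edgeEnds] at this
    simp only [hΨ, ht]
    rw [neg_sub_neg]
    exact this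

/-- At most half of the points are near one of the planes where a height is extremal. -/
lemma card_not_flat_le {L : ℕ} [NeZero L] {r : ℕ} (hr : 24 * r ≤ 2 * L) [DecidablePred
    fun x : Torus (2 * L) => ¬ Flat (r : ℤ) x] :
    2 * (Finset.univ.filter fun x : Torus (2 * L) => ¬ Flat (r : ℤ) x).card ≤ (2 * L) ^ 3 := by
  classical
  let Bad : ZMod (2 * L) → Prop := fun a =>
    ¬ ((r ≤ a.val ∧ a.val + r ≤ L) ∨ (L + r ≤ a.val ∧ a.val + r ≤ 2 * L))
  have hbad : (Finset.univ.filter Bad).card ≤ 4 * r := by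
    have h1 : (Finset.univ.filter Bad).card ≤
        (Finset.range r ∪ Finset.Ioo (L - r) (L + r) ∪ Finset.Ioo (2 * L - r) (2 * L)).card := by
      refine Finset.card_le_card_of_injOn ZMod.val ?_ (ZMod.val_injective _).injOn
      intro a ha
      have ha' : Bad a := by simpa using ha
      have hlt : a.val < 2 * L := ZMod.val_lt a
      simp only [Bad] at ha'
      simp only [Finset.coe_union, Set.mem_union, Finset.mem_coe, Finset.mem_range, Finset.mem_Ioo]
      omega
    have h2 := Finset.card_union_le (Finset.range r ∪ Finset.Ioo (L - r) (L + r))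
      (Finset.Ioo (2 * L - r) (2 * L))
    have h3 := Finset.card_union_le (Finset.range r) (Finset.Ioo (L - r) (L + r))
    rw [Finset.card_range, Nat.card_Ioo] at h3
    rw [Nat.card_Ioo] at h2
    omega
  have hsub : (Finset.univ.filter fun x : Torus (2 * L) => ¬ Flat (r : ℤ) x) ⊆
      Finset.univ.biUnion fun j : Fin 3 =>
        Finset.univ.filter fun x : Torus (2 * L) => Bad (x j) := by
    intro x hx
    have hx := (Finset.mem_filter.1 hx).2
    by_contra hcon
    simp only [Finset.mem_biUnion, Finset.mem_filter, Finset.mem_univ, true_and, not_exists] at hcon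
    refine hx (Flat.of_val fun j => ?_)
    have := not_not.1 (hcon j)
    omega
  have h1 := (Finset.card_le_card hsub).trans Finset.card_biUnion_le
  simp only [card_filter_apply_eq _ Bad, Finset.sum_const, Finset.card_univ, Fintype.card_fin,
    smul_eq_mul] at h1
  calc _ ≤ 2 * (3 * ((Finset.univ.filter Bad).card * (2 * L) ^ 2)) := by omega
    _ ≤ 2 * (3 * (4 * r * (2 * L) ^ 2)) := by gcongr
    _ = 24 * r * (2 * L) ^ 2 := by ring
    _ ≤ 2 * L * (2 * L) ^ 2 := by gcongr
    _ = (2 * L) ^ 3 := by ring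

lemma height_mem_Icc {L : ℕ} [NeZero L] (a : ZMod (2 * L)) :
    0 ≤ height (2 * L) a ∧ height (2 * L) a ≤ L := by
  have h1 : (a.val : ℝ) ≤ ((2 * L : ℕ) : ℝ) := by exact_mod_cast (ZMod.val_lt a).le
  have h2 : (0 : ℝ) ≤ a.val := Nat.cast_nonneg _
  push_cast at h1
  simp only [height]
  push_cast
  refine ⟨le_min h2 (by linarith), ?_⟩
  rcases le_total (a.val : ℝ) L with h | h
  · exact (min_le_left _ _).trans h
  · exact (min_le_right _ _).trans (by linarith)

lemma height_plane {L : ℕ} [NeZero L] (b : Bool) :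
    height (2 * L) (plane L b) = if b then (L : ℝ) else 0 := by
  cases b
  · simp [plane, height]
  · have := height_intCast_of_le (L := L) (a := L) (by simp) le_rfl
    simpa [plane] using this

/-- The `j`-th height, extended to the terminals: the `j`-th pair is at distance `L / 2` from its
planes, on the outer side, and the other terminals are at the middle height `L / 2`, at distance at
most `L / 2` from every point. -/
noncomputable def terminalHeight (L : ℕ) (j : Fin 3) : TorusVertex L → ℝ
  | .inl (i, b) => if i = j then (if b then 3 * L / 2 else -(L / 2)) else L / 2
  | .inr x => height (2 * L) (x j)

/-- In the torus graph, the heights show that the demand needs a large congestion. -/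
lemma le_congestion_torusGraph {L N : ℕ} [NeZero L] (hL : 96 * 2 ^ (2 * N) ≤ L) :
    ENNReal.ofReal (3 / (428 * ((2 * L : ℕ) : ℝ) ^ 2)) ≤
      congestion (torusGraph L N) (fun t : terminals L => (t : TorusVertex L))
        (unitDemand (IsDemandPair L)) := by
  classical
  have hLpos : (0 : ℝ) < L := by exact_mod_cast NeZero.pos L
  let len : EdgeClass L → ℝ := Sum.elim (fun _ => 1) (fun _ => L / 2)
  let idx : terminals L → Fin 3 := fun b => Sum.elim Prod.fst (fun _ => 0) b.1
  have hlen : ∀ c, 0 ≤ len c := by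
    rintro (c | c) <;> simp only [len, Sum.elim_inl, Sum.elim_inr] <;> positivity
  have hlip : ∀ j (e : TorusEdge L N), |terminalHeight L j (edgeEnds L e.1).1 -
      terminalHeight L j (edgeEnds L e.1).2| ≤ len e.1 := by
    rintro j ⟨⟨v, x⟩ | ⟨i, b, x⟩, k⟩
    · have := abs_slope_le v x j
      rw [abs_sub_comm]
      exact this
    · have hx : x i = plane L b := by
        by_contra hne
        have hk := k.2
        simp [edgeCap, hne] at hk
      simp only [edgeEnds, terminalHeight, len, Sum.elim_inr]
      by_cases hij : i = j
      · subst hij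
        rw [if_pos rfl, hx, height_plane]
        cases b <;> simp only [Bool.false_eq_true, if_true, if_false] <;> rw [abs_le] <;>
          constructor <;> linarith
      · rw [if_neg hij, abs_le]
        have := height_mem_Icc (x j)
        constructor <;> linarith [this.1, this.2]
  have hgain : ∑ a, ∑ b, (if IsDemandPair L a b then
      -terminalHeight L (idx b) (a : TorusVertex L) - -terminalHeight L (idx b) (b : TorusVertex L)
        else 0) = 6 * L := by
    rw [sum_isDemandPair]
    simp only [idx, terminal, terminalHeight, Sum.elim_inl]
    rw [Fin.sum_univ_three]
    simp
    ring
  have htotal : ∑ e : TorusEdge L N, len e.1 ≤ 428 * ((2 * L : ℕ) : ℝ) ^ 3 := by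
    rw [sum_torusEdge]
    simp only [len, Sum.elim_inl, Sum.elim_inr, mul_one, Finset.sum_const, nsmul_eq_mul]
    have hcardp : ∀ j b, ((Finset.univ.filter fun x : Torus (2 * L) => x j = plane L b).card : ℝ) =
        ((2 * L : ℕ) : ℝ) ^ 2 := by
      intro j b
      rw [card_filter_apply_eq j (fun a => a = plane L b), Finset.filter_eq' Finset.univ]
      simp
    simp only [hcardp, Finset.sum_const, Finset.card_univ, nsmul_eq_mul]
    have hcap : ∑ x : Torus (2 * L), (interiorCap L N x : ℝ) ≤ 26.5 * ((2 * L : ℕ) : ℝ) ^ 3 := by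
      have h1 : ∀ x : Torus (2 * L), (interiorCap L N x : ℝ) =
          26 + if ¬ Flat ((8 * 2 ^ (2 * N) : ℕ) : ℤ) x then 1 else 0 := by
        intro x
        simp only [interiorCap]
        push_cast
        split_ifs <;> first | contradiction | norm_num
      have h2 := card_not_flat_le (L := L) (r := 8 * 2 ^ (2 * N)) (by omega)
      have h3 : (2 : ℝ) * (Finset.univ.filter fun x : Torus (2 * L) =>
          ¬ Flat ((8 * 2 ^ (2 * N) : ℕ) : ℤ) x).card ≤ ((2 * L : ℕ) : ℝ) ^ 3 := by exact_mod_cast h2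
      simp only [h1, Finset.sum_add_distrib, Finset.sum_boole, Finset.sum_const, Finset.card_univ,
        nsmul_eq_mul]
      have h4 : (Fintype.card (Torus (2 * L)) : ℝ) = ((2 * L : ℕ) : ℝ) ^ 3 := by
        simp [Torus, ZMod.card]
      rw [h4]
      linarith
    have h8 : (Fintype.card Dir : ℝ) = 8 := by simp [Dir]
    rw [h8]
    simp only [Fintype.card_fin, Fintype.card_bool]
    have hm : ((2 * L : ℕ) : ℝ) = 2 * L := by push_cast; ring
    have hm3 : ((2 * L : ℕ) : ℝ) ^ 2 * L = ((2 * L : ℕ) : ℝ) ^ 3 / 2 := by rw [hm]; ring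
    push_cast at hm3 hcap ⊢
    nlinarith
  refine le_congestion_unitDemand (ℓ := fun e => len e.1)
    (φ := fun b x => -terminalHeight L (idx b) x) IsDemandPair.not_swap ?_
    (fun e => hlen e.1) ?_ ?_ ?_
  · exact fun e => (torusGraph_isLink e).edge_mem
  · rintro b e x y (⟨rfl, rfl⟩ | ⟨rfl, rfl⟩)
    · rw [neg_sub_neg, abs_sub_comm]
      exact hlip _ e
    · rw [neg_sub_neg]
      exact hlip _ e
  · rw [hgain]
    positivity
  · rw [hgain]
    refine (mul_le_mul_of_nonneg_left htotal (by positivity)).trans (le_of_eq ?_)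
    push_cast
    field_simp
    ring

end FlowSparsifier

theorem theorem1p2 (N : ℕ) (hN : 0 < N) :
    ∃ (V E : Type) (_ : Finite V) (_ : Finite E) (G : Graph V E) (T : Finset V),
      (T : Set V) ⊆ G.vertexSet ∧ T.card = 6 ∧
      ∀ 𝓕 : Setoid V,
        (∀ s ∈ T, ∀ t ∈ T, 𝓕 s t → s = t) →
        (FlowSparsifier.contract G 𝓕).vertexSet.ncard ≤ N →
        ∀ q : ℝ,
          FlowSparsifier.IsFlowSparsifier G (fun t : T => (t : V))
            (FlowSparsifier.contract G 𝓕) (fun t : T => Quotient.mk 𝓕 (t : V)) q →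
          1 + 1 / 10 ^ 18 ≤ q := by
  -- The factor `96` makes the slabs that are not flat fill at most half of the torus.
  set L : ℕ := 96 * 2 ^ (2 * N) with hL
  have : NeZero L := ⟨by positivity⟩
  refine ⟨FlowSparsifier.TorusVertex L, FlowSparsifier.TorusEdge L N, inferInstance, inferInstance,
    FlowSparsifier.torusGraph L N, FlowSparsifier.terminals L, Set.subset_univ _,
    by simp [FlowSparsifier.terminals], ?_⟩
  rintro 𝓕 - hcard q ⟨hq, hD⟩
  have h1 := (hD (FlowSparsifier.unitDemand (FlowSparsifier.IsDemandPair L))).2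
  have h2 := FlowSparsifier.congestion_contract_le hN 𝓕 hcard
  have h3 := FlowSparsifier.le_congestion_torusGraph (L := L) (N := N) le_rfl
  have h4 := h3.trans (h1.trans (mul_le_mul_right h2 _))
  have hLpos : (0 : ℝ) < ((2 * L : ℕ) : ℝ) := by
    have := NeZero.pos L
    positivity
  rw [← ENNReal.ofReal_mul (by linarith), ENNReal.ofReal_le_ofReal_iff (by positivity)] at h4
  rw [mul_one_div, div_le_div_iff₀ (by positivity) (by positivity)] at h4
  have h5 : 3 * 143.5 * ((2 * L : ℕ) : ℝ) ^ 2 ≤ q * 428 * ((2 * L : ℕ) : ℝ) ^ 2 := by linarith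
  have h6 := le_of_mul_le_mul_right h5 (by positivity)
  norm_num at h6 ⊢
  linarith
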